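/- All graphs are finite, without multiple edges, possibly with loops; $e(G)$ is the number of non-loop edges of $G$, and a vertex is isolated if it lies on no edge and no loop. A graphex is a triple $\mathcal W=(I,S,W)$ with $I\ge 0$, $S:\mathbb R_+\to\mathbb R_+$ measurable with $\min(S,1)$ integrable, and $W:\mathbb R_+^2\to[0,1]$ symmetric and measurable such that, with $\mu_W(y)=\int W(x,y)\,dx$, one has $|\{\mu_W=\infty\}|=0$, $|\{\mu_W>1\}|<\infty$, $\int\int W(x,y)1[\mu_W(x)\le 1]1[\mu_W(y)\le 1]\,dx\,dy<\infty$ and $\int W(x,x)\,dx<\infty$. It generates the random adjacency measure $$\xi=\sum_{i,j}1[\zeta_{\{i,j\}}\le W(\vartheta_i,\vartheta_j)]\delta_{(\theta_i,\theta_j)}+\sum_{j,k}1[\chi_{jk}\le S(\vartheta_j)](\delta_{(\theta_j,\sigma_{jk})}+\delta_{(\sigma_{jk},\theta_j)})+\sum_k1[\eta_k\le I](\delta_{(\rho_k,\rho'_k)}+\delta_{(\rho'_k,\rho_k)}),$$ where $\{(\theta_j,\vartheta_j)\}_j$, $\{(\sigma_{jk},\chi_{jk})\}_k$ (for each $j$)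 are unit rate Poisson processes on $\mathbb R_+^2$, $\{(\rho_k,\rho'_k,\eta_k)\}_k$ is a unit rate Poisson process on $\mathbb R_+^3$, the $\zeta_{\{i,j\}}$ are uniform on $[0,1]$, and all of them are independent. For $r\in\mathbb R_+$, $\mathrm{GPD}(\mathcal W,r)$ is the law of the (a.s. finite) unlabeled graph without isolated vertices whose edges are the atoms of $\xi$ in $[0,r]^2$. For a graph $G$ and $r\in\mathbb R_+$, let $\mathrm{Smpl}(G,r)$ be the law of the unlabeled graph obtained by keeping each vertex of $G$ independently with probability $\min\bigl(r/\sqrt{2e(G)},1\bigr)$, taking the induced subgraph and discarding its isolated vertices. A sequence $G_1,G_2,\dots$ is sampling convergent to $\mathcal W$ if $\mathrm{Smpl}(G_j,r)\to\mathrm{GPD}(\mathcal W,r)$ weakly as $j\to\infty$ for every $r\in\mathbb R_+$. The empirical graphon $W^G:[0,1]^2\to\{0,1\}$ of a graph $G$ with $v$ vertices (in an arbitrary order) is the function equal on the square $(i,j)$ of the $v\times v$ grid to $1$ if $\{i,j\}$ is an edge (or a loop, when $i=j$) of $G$ and to $0$ otherwise; the stretched empirical graphon is $W^{G,s}(x,y)=W^G(\|W^G\|_1^{1/2}x,\|W^G\|_1^{1/2}y)$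 for $x,y\in[0,\|W^G\|_1^{-1/2})$ and $0$ for other $x,y$, and it is identified with the graphex $(0,0,W^{G,s})$. **Lemma.** Let $G_1,G_2,\dots$ be a sequence of graphs with $e(G_j)\to\infty$, and let $\mathcal W$ be a graphex. The following are equivalent: (1) the sequence $G_1,G_2,\dots$ is sampling convergent to $\mathcal W$; (2) for all $r\in\mathbb R_+$, $\mathrm{GPD}(W^{G_j,s},r)\to\mathrm{GPD}(\mathcal W,r)$ weakly as $j\to\infty$. -/

import Mathlib

open MeasureTheory ProbabilityTheory Filter Topology
open scoped NNReal ENNReal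

namespace GraphexSampling

noncomputable section

/-! ### Graphs with loops and unlabeled graphs -/

/-- A graph on `V` without multiple edges; loops are allowed. -/
structure LoopGraph (V : Type*) where
  Adj : V → V → Prop
  symm : ∀ x y, Adj x y → Adj y x

namespace LoopGraph

variable {V : Type*}

/-- The edges (loops included), as unordered pairs. -/
def edgeSet (G : LoopGraph V) : Set (Sym2 V) :=
  {e | ∃ x y, G.Adj x y ∧ e = s(x, y)}

/-- `e(G)`: the number of non-loop edges. -/
def numEdges (G : LoopGraph V) : ℕ := {e | e ∈ G.edgeSet ∧ ¬ e.IsDiag}.ncard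

/-- The non-isolated vertices, i.e. those lying on some edge or loop. -/
def support (G : LoopGraph V) : Set V := {x | ∃ y, G.Adj x y}

/-- The graph pulled back along a map of vertices. -/
def comap {U : Type*} (f : U → V) (G : LoopGraph V) : LoopGraph U where
  Adj x y := G.Adj (f x) (f y)
  symm x y h := G.symm _ _ h

/-- The vertex-induced subgraph on `s`. -/
def induce (G : LoopGraph V) (s : Set V) : LoopGraph s := G.comap Subtype.val

/-- The graph without vertices. -/
def empty : LoopGraph (Fin 0) where
  Adj _ _ := False
  symm _ _ := False.elim

theorem adj_injective : Function.Injective (LoopGraph.Adj : LoopGraph V → V → V → Prop) := by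
  rintro ⟨A, _⟩ ⟨B, _⟩ h
  cases h
  rfl

instance [Finite V] : Finite (LoopGraph V) := Finite.of_injective _ adj_injective

end LoopGraph

/-- Two finite graphs are identified when they are isomorphic. -/
instance graphSetoid : Setoid (Σ n : ℕ, LoopGraph (Fin n)) where
  r G H := Nonempty (G.2.Adj ≃r H.2.Adj)
  iseqv :=
    { refl := fun G => ⟨RelIso.refl _⟩
      symm := fun ⟨e⟩ => ⟨e.symm⟩
      trans := fun ⟨e⟩ ⟨f⟩ => ⟨e.trans f⟩ }

/-- Finite unlabeled graphs (loops allowed): isomorphism classes of finite graphs. -/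
def UnlabeledGraph : Type := Quotient graphSetoid

namespace UnlabeledGraph

instance : Countable UnlabeledGraph := inferInstanceAs (Countable (Quotient graphSetoid))

/-- The space of finite unlabeled graphs is discrete. -/
instance : TopologicalSpace UnlabeledGraph := ⊥

instance : DiscreteTopology UnlabeledGraph := ⟨rfl⟩

instance : MeasurableSpace UnlabeledGraph := ⊤

instance : DiscreteMeasurableSpace UnlabeledGraph := ⟨fun _ => trivial⟩

/-- The isomorphism class of a graph on `Fin n`. -/
def mk {n : ℕ} (H : LoopGraph (Fin n)) : UnlabeledGraph := Quotient.mk graphSetoid ⟨n, H⟩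

theorem mk_eq_mk {n m : ℕ} {G : LoopGraph (Fin n)} {H : LoopGraph (Fin m)} :
    mk G = mk H ↔ Nonempty (G.Adj ≃r H.Adj) :=
  Quotient.eq (r := graphSetoid)

theorem exists_eq_mk (q : UnlabeledGraph) : ∃ (n : ℕ) (H : LoopGraph (Fin n)), q = mk H := by
  obtain ⟨⟨n, H⟩, h⟩ := Quotient.exists_rep q
  exact ⟨n, H, h.symm⟩

end UnlabeledGraph

namespace LoopGraph

variable {V : Type*}

open Classical in
/-- The unlabeled graph obtained by discarding the isolated vertices of `G` and forgetting the
labels. It is meant for graphs with finitely many non-isolated vertices; for the others the value is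
the empty graph. -/
def unlabel (G : LoopGraph V) : UnlabeledGraph :=
  if h : Finite G.support then
    UnlabeledGraph.mk ((G.induce G.support).comap (Finite.equivFin G.support).symm)
  else UnlabeledGraph.mk LoopGraph.empty

/-- Criterion for the unlabeled graph of `G` to be the class of `H`. -/
theorem exists_embedding_iff (G : LoopGraph V) (n : ℕ) (H : LoopGraph (Fin n)) :
    (∃ f : Fin n → V, Function.Injective f ∧ (∀ a b, H.Adj a b ↔ G.Adj (f a) (f b)) ∧
      Set.range f = G.support) ↔
      Finite G.support ∧ G.unlabel = UnlabeledGraph.mk H := by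
  constructor
  · rintro ⟨f, hf, hadj, hr⟩
    have hfin : Finite G.support := hr ▸ (Set.finite_range f).to_subtype
    refine ⟨hfin, ?_⟩
    rw [unlabel, dif_pos hfin, UnlabeledGraph.mk_eq_mk]
    let e : Fin n ≃ G.support :=
      (Equiv.ofInjective f hf).trans (Equiv.setCongr hr)
    refine ⟨⟨(Finite.equivFin G.support).symm.trans e.symm, ?_⟩⟩
    intro a b
    have key : ∀ x : G.support, f (e.symm x) = x := by
      intro x
      have : (e (e.symm x) : V) = f (e.symm x) := rfl
      rw [← this, e.apply_symm_apply]
    show H.Adj (e.symm _) (e.symm _) ↔ _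
    rw [hadj, key, key]
    rfl
  · rintro ⟨hfin, hq⟩
    rw [unlabel, dif_pos hfin, UnlabeledGraph.mk_eq_mk] at hq
    obtain ⟨e⟩ := hq
    refine ⟨fun a => ((Finite.equivFin G.support).symm (e.symm a) : V), ?_, ?_, ?_⟩
    · exact Subtype.val_injective.comp
        ((Finite.equivFin G.support).symm.injective.comp e.symm.injective)
    · intro a b
      exact (e.symm.map_rel_iff (a := a) (b := b)).symm
    · ext x
      constructor
      · rintro ⟨a, rfl⟩
        exact Subtype.property _
      · intro hx
        refine ⟨e (Finite.equivFin G.support ⟨x, hx⟩), ?_⟩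
        show ((Finite.equivFin G.support).symm (e.symm (e _)) : V) = x
        rw [e.symm_apply_apply, Equiv.symm_apply_apply]

end LoopGraph

/-! ### `p`-sampling -/

/-- The law of the `p`-sampling of a finite graph: every vertex is kept independently with
probability `min p 1`, isolated vertices of the induced subgraph are discarded, and the labels are
forgotten. -/
def sampling {n : ℕ} (G : LoopGraph (Fin n)) (p : ℝ≥0) : ProbabilityMeasure UnlabeledGraph :=
  ⟨(setBernoulli Set.univ
      (⟨min (p : ℝ) 1, le_min p.2 zero_le_one, min_le_right _ _⟩ : unitInterval)).map
      (fun U : Set (Fin n) => (G.induce U).unlabel),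
    Measure.isProbabilityMeasure_map (measurable_of_countable _).aemeasurable⟩

/-- The canonical sampling distribution with parameter `s`: `p`-sampling with
`p = s / √(2 e(G))`. -/
def sampD {n : ℕ} (G : LoopGraph (Fin n)) (s : ℝ≥0) : ProbabilityMeasure UnlabeledGraph :=
  sampling G (s / NNReal.sqrt (2 * (G.numEdges : ℝ≥0)))

/-! ### Graphexes -/

/-- Lebesgue measure on the half-line `[0, ∞)`. -/
def leb : Measure ℝ≥0 := (volume : Measure ℝ).comap ((↑) : ℝ≥0 → ℝ)

theorem leb_Iio (c : ℝ≥0) : leb (Set.Iio c) = c := by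
  have hemb : MeasurableEmbedding ((↑) : ℝ≥0 → ℝ) :=
    MeasurableEmbedding.subtype_coe measurableSet_Ici
  rw [leb, hemb.comap_apply]
  have : ((↑) : ℝ≥0 → ℝ) '' Set.Iio c = Set.Ico (0 : ℝ) c := by
    ext x
    constructor
    · rintro ⟨y, hy, rfl⟩
      exact ⟨y.2, hy⟩
    · rintro ⟨h0, h1⟩
      exact ⟨⟨x, h0⟩, h1, rfl⟩
  rw [this, Real.volume_Ico, sub_zero, ENNReal.ofReal_coe_nnreal]

/-- The marginal `μ_W(y) = ∫ W(x, y) dx`. -/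
def marginal (W : ℝ≥0 → ℝ≥0 → ℝ≥0) (y : ℝ≥0) : ℝ≥0∞ := ∫⁻ x, W x y ∂leb

/-- The `L¹` norm `‖W‖₁ = ∫∫ W(x, y) dx dy`. -/
def l1Norm (W : ℝ≥0 → ℝ≥0 → ℝ≥0) : ℝ≥0∞ := ∫⁻ x, ∫⁻ y, W x y ∂leb ∂leb

open Classical in
/-- A graphex `(I, S, W)`: `I ≥ 0`, `S` is measurable with `min(S, 1)` integrable, and `W` is a
graphon, i.e. a symmetric measurable function with values in `[0, 1]` satisfying the last four
conditions. -/
structure Graphex where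
  I : ℝ≥0
  S : ℝ≥0 → ℝ≥0
  W : ℝ≥0 → ℝ≥0 → ℝ≥0
  measurable_S : Measurable S
  integrable_S : ∫⁻ x, (min (S x) 1 : ℝ≥0) ∂leb < ∞
  measurable_W : Measurable (Function.uncurry W)
  W_le_one : ∀ x y, W x y ≤ 1
  W_symm : ∀ x y, W x y = W y x
  marginal_ne_top : leb {x | marginal W x = ∞} = 0
  marginal_gt_one : leb {x | 1 < marginal W x} < ∞
  integrable_W : ∫⁻ x, ∫⁻ y,
    (if marginal W x ≤ 1 ∧ marginal W y ≤ 1 then (W x y : ℝ≥0∞) else 0) ∂leb ∂leb < ∞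
  integrable_diag : ∫⁻ x, W x x ∂leb < ∞

/-! ### Poisson processes

The unit rate Poisson process on `[0, ∞)^d` is realized cell by cell: in the unit cube with lower
corner `c ∈ ℕ^d` there is a Poisson(1) number of points, which are independent and uniform in the
cube; different cubes are independent. -/

/-- The `m`-th potential point of the cube with lower corner `c` has index `(c, m)`. -/
abbrev PointIndex (d : ℕ) : Type := (Fin d → ℕ) × ℕ

/-- Sample space: the number of points of each cube, and the position of each potential point
relative to the lower corner of its cube. -/
abbrev PoissonSpace (d : ℕ) : Type := ((Fin d → ℕ) → ℕ) × (PointIndex d → Fin d → unitInterval)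

def poissonLaw (d : ℕ) : Measure (PoissonSpace d) :=
  (Measure.infinitePi fun _ : Fin d → ℕ => poissonMeasure 1).prod
    (Measure.infinitePi fun _ : PointIndex d =>
      Measure.pi fun _ : Fin d => (volume : Measure unitInterval))

instance (d : ℕ) : IsProbabilityMeasure (poissonLaw d) := by
  unfold poissonLaw
  infer_instance

/-- The potential point with index `i` is an actual point of the process. -/
def IsPoint {d : ℕ} (ω : PoissonSpace d) (i : PointIndex d) : Prop := i.2 < ω.1 i.1

/-- The `k`-th coordinate of the point with index `i`. -/
def coord {d : ℕ} (ω : PoissonSpace d) (i : PointIndex d) (k : Fin d) : ℝ≥0 :=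
  (i.1 k : ℝ≥0) + unitInterval.toNNReal (ω.2 i k)

/-! ### The graphex process -/

/-- Sample space of the graphex process: the process `{(θ_j, ϑ_j)}`, the processes
`{(σ_jk, χ_jk)}_k` for every `j`, the process `{(ρ_k, ρ'_k, η_k)}`, and the array `ζ_{i,j}`. -/
abbrev DrivingSpace : Type :=
  PoissonSpace 2 × (PointIndex 2 → PoissonSpace 2) × PoissonSpace 3 ×
    (Sym2 (PointIndex 2) → unitInterval)

/-- All components are independent. -/
def drivingLaw : Measure DrivingSpace :=
  (poissonLaw 2).prod ((Measure.infinitePi fun _ : PointIndex 2 => poissonLaw 2).prod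
    ((poissonLaw 3).prod
      (Measure.infinitePi fun _ : Sym2 (PointIndex 2) => (volume : Measure unitInterval))))

instance : IsProbabilityMeasure drivingLaw := by
  unfold drivingLaw
  infer_instance

namespace DrivingSpace

def θ (ω : DrivingSpace) (j : PointIndex 2) : ℝ≥0 := coord ω.1 j 0
def ϑ (ω : DrivingSpace) (j : PointIndex 2) : ℝ≥0 := coord ω.1 j 1
def σ (ω : DrivingSpace) (j k : PointIndex 2) : ℝ≥0 := coord (ω.2.1 j) k 0
def χ (ω : DrivingSpace) (j k : PointIndex 2) : ℝ≥0 := coord (ω.2.1 j) k 1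
def ρ (ω : DrivingSpace) (k : PointIndex 3) : ℝ≥0 := coord ω.2.2.1 k 0
def ρ' (ω : DrivingSpace) (k : PointIndex 3) : ℝ≥0 := coord ω.2.2.1 k 1
def η (ω : DrivingSpace) (k : PointIndex 3) : ℝ≥0 := coord ω.2.2.1 k 2
def ζ (ω : DrivingSpace) (e : Sym2 (PointIndex 2)) : ℝ≥0 := unitInterval.toNNReal (ω.2.2.2 e)

end DrivingSpace

open DrivingSpace

/-- The pair of points `i`, `j` contributes to the graphon part. -/
def graphonEvent (𝓦 : Graphex) (ω : DrivingSpace) (i j : PointIndex 2) : Prop :=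
  IsPoint ω.1 i ∧ IsPoint ω.1 j ∧ ζ ω s(i, j) ≤ 𝓦.W (ϑ ω i) (ϑ ω j)

/-- The `k`-th point of the `j`-th star process contributes to the star part. -/
def starEvent (𝓦 : Graphex) (ω : DrivingSpace) (j k : PointIndex 2) : Prop :=
  IsPoint ω.1 j ∧ IsPoint (ω.2.1 j) k ∧ χ ω j k ≤ 𝓦.S (ϑ ω j)

/-- The `k`-th point contributes to the isolated edges part. -/
def isoEvent (𝓦 : Graphex) (ω : DrivingSpace) (k : PointIndex 3) : Prop :=
  IsPoint ω.2.2.1 k ∧ η ω k ≤ 𝓦.I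

open Classical in
/-- The random adjacency measure `ξ` generated by a graphex. -/
def adjacencyMeasure (𝓦 : Graphex) (ω : DrivingSpace) : Measure (ℝ≥0 × ℝ≥0) :=
  Measure.sum (fun p : PointIndex 2 × PointIndex 2 =>
      if graphonEvent 𝓦 ω p.1 p.2 then Measure.dirac (θ ω p.1, θ ω p.2) else 0) +
    Measure.sum (fun p : PointIndex 2 × PointIndex 2 =>
      if starEvent 𝓦 ω p.1 p.2 then
        Measure.dirac (θ ω p.1, σ ω p.1 p.2) + Measure.dirac (σ ω p.1 p.2, θ ω p.1) else 0) +
    Measure.sum (fun k : PointIndex 3 =>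
      if isoEvent 𝓦 ω k then
        Measure.dirac (ρ ω k, ρ' ω k) + Measure.dirac (ρ' ω k, ρ ω k) else 0)

/-- The graph with labels in `[0, ∞)` whose edges are the atoms of `ξ`. (For a symmetric `ξ` the two
alternatives in the definition are equivalent.) -/
def graphOfMeasure (ξ : Measure (ℝ≥0 × ℝ≥0)) : LoopGraph ℝ≥0 where
  Adj x y := ξ {(x, y)} ≠ 0 ∨ ξ {(y, x)} ≠ 0
  symm _ _ h := h.symm

/-- The graphex process `Γ_s`: the graph of the restriction of `ξ` to `[0, s]²`. -/
def graphexProcess (𝓦 : Graphex) (s : ℝ≥0) (ω : DrivingSpace) : LoopGraph ℝ≥0 :=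
  graphOfMeasure ((adjacencyMeasure 𝓦 ω).restrict (Set.Icc 0 s ×ˢ Set.Icc 0 s))

/-! Measurability of the unlabeled graphex process. -/

/-- A random graph whose edges are enumerated by countably many measurable random edges has a
measurable unlabeled version. -/
theorem measurable_unlabel {Ω K L : Type*} [MeasurableSpace Ω] [Countable K] [MeasurableSpace L]
    [MeasurableEq L] (C : K → Ω → Prop) (x y : K → Ω → L)
    (hC : ∀ k, Measurable (C k)) (hx : ∀ k, Measurable (x k)) (hy : ∀ k, Measurable (y k))
    (Γ : Ω → LoopGraph L)
    (hΓ : ∀ ω u v, (Γ ω).Adj u v ↔ ∃ k, C k ω ∧ x k ω = u ∧ y k ω = v) :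
    Measurable fun ω => (Γ ω).unlabel := by
  have hA : ∀ (n : ℕ) (H : LoopGraph (Fin n)),
      Measurable fun ω => Finite (Γ ω).support ∧ (Γ ω).unlabel = UnlabeledGraph.mk H := by
    intro n H
    have hset : (fun ω => Finite (Γ ω).support ∧ (Γ ω).unlabel = UnlabeledGraph.mk H) =
        fun ω => ∃ κ : Fin n → K, (∀ a, C (κ a) ω) ∧ (∀ a b, x (κ a) ω = x (κ b) ω → a = b) ∧
          (∀ a b, H.Adj a b ↔ ∃ k, C k ω ∧ x k ω = x (κ a) ω ∧ y k ω = x (κ b) ω) ∧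
          ∀ k, C k ω → ∃ a, x k ω = x (κ a) ω := by
      funext ω
      rw [← LoopGraph.exists_embedding_iff]
      apply propext
      constructor
      · rintro ⟨f, hf, hadj, hr⟩
        have : ∀ a, ∃ k, C k ω ∧ x k ω = f a := by
          intro a
          have ha : f a ∈ (Γ ω).support := hr ▸ Set.mem_range_self a
          obtain ⟨v, hv⟩ := ha
          obtain ⟨k, h1, h2, -⟩ := (hΓ ω _ _).1 hv
          exact ⟨k, h1, h2⟩
        choose κ h1 h2 using this
        refine ⟨κ, h1, ?_, ?_, ?_⟩
        · intro a b hab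
          rw [h2, h2] at hab
          exact hf hab
        · intro a b
          rw [hadj, hΓ, h2, h2]
        · intro k hk
          have : x k ω ∈ (Γ ω).support := ⟨y k ω, (hΓ _ _ _).2 ⟨k, hk, rfl, rfl⟩⟩
          rw [← hr] at this
          obtain ⟨a, ha⟩ := this
          exact ⟨a, by rw [h2, ha]⟩
      · rintro ⟨κ, h1, hinj, hadj, hcov⟩
        refine ⟨fun a => x (κ a) ω, fun a b h => hinj a b h, ?_, ?_⟩
        · intro a b
          rw [hadj, hΓ]
        · ext u
          constructor
          · rintro ⟨a, rfl⟩
            exact ⟨y (κ a) ω, (hΓ _ _ _).2 ⟨_, h1 a, rfl, rfl⟩⟩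
          · rintro ⟨v, hv⟩
            obtain ⟨k, hk, rfl, -⟩ := (hΓ _ _ _).1 hv
            obtain ⟨a, ha⟩ := hcov k hk
            exact ⟨a, ha.symm⟩
    rw [hset]
    fun_prop
  have hfin : Measurable fun ω => Finite (Γ ω).support := by
    have : (fun ω => Finite (Γ ω).support) = fun ω => ∃ q : Σ n : ℕ, LoopGraph (Fin n),
        Finite (Γ ω).support ∧ (Γ ω).unlabel = UnlabeledGraph.mk q.2 := by
      funext ω
      apply propext
      constructor
      · intro h
        obtain ⟨n, H, hq⟩ := UnlabeledGraph.exists_eq_mk ((Γ ω).unlabel)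
        exact ⟨⟨n, H⟩, h, hq⟩
      · rintro ⟨_, h, -⟩
        exact h
    rw [this]
    exact Measurable.exists fun q => hA q.1 q.2
  refine measurable_to_countable' fun q => ?_
  obtain ⟨n, H, rfl⟩ := UnlabeledGraph.exists_eq_mk q
  have : (fun ω => (Γ ω).unlabel) ⁻¹' {UnlabeledGraph.mk H} =
      {ω | (Finite (Γ ω).support ∧ (Γ ω).unlabel = UnlabeledGraph.mk H) ∨
        (¬ Finite (Γ ω).support ∧ UnlabeledGraph.mk LoopGraph.empty = UnlabeledGraph.mk H)} := by
    ext ω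
    by_cases h : Finite (Γ ω).support
    · simp [h]
    · have : (Γ ω).unlabel = UnlabeledGraph.mk LoopGraph.empty := by
        rw [LoopGraph.unlabel, dif_neg h]
      simp only [Set.mem_preimage, Set.mem_singleton_iff, Set.mem_ofPred_eq, h, this, false_and,
        false_or, not_false_eq_true, true_and]
  rw [this, measurableSet_setOfPred]
  exact (hA n H).or (hfin.not.and measurable_const)

theorem measurable_toNNReal : Measurable unitInterval.toNNReal :=
  Measurable.subtype_mk measurable_subtype_coe

theorem measurable_isPoint {d : ℕ} (i : PointIndex d) :
    Measurable fun ω : PoissonSpace d => IsPoint ω i :=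
  measurable_const.lt ((measurable_pi_apply _).comp measurable_fst)

theorem measurable_coord {d : ℕ} (i : PointIndex d) (k : Fin d) :
    Measurable fun ω : PoissonSpace d => coord ω i k :=
  measurable_const.add (measurable_toNNReal.comp
    ((measurable_pi_apply k).comp ((measurable_pi_apply i).comp measurable_snd)))

theorem measurable_unlabel_graphexProcess (𝓦 : Graphex) (s : ℝ≥0) :
    Measurable fun ω => (graphexProcess 𝓦 s ω).unlabel := by
  have hθ : ∀ j, Measurable fun ω : DrivingSpace => θ ω j := fun j =>
    (measurable_coord j 0).comp measurable_fst
  have hϑ : ∀ j, Measurable fun ω : DrivingSpace => ϑ ω j := fun j =>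
    (measurable_coord j 1).comp measurable_fst
  have hs : ∀ j, Measurable fun ω : DrivingSpace => ω.2.1 j := fun j =>
    (measurable_pi_apply j).comp (measurable_fst.comp measurable_snd)
  have hσ : ∀ j k, Measurable fun ω : DrivingSpace => σ ω j k := fun j k =>
    (measurable_coord k 0).comp (hs j)
  have hχ : ∀ j k, Measurable fun ω : DrivingSpace => χ ω j k := fun j k =>
    (measurable_coord k 1).comp (hs j)
  have h3 : Measurable fun ω : DrivingSpace => ω.2.2.1 :=
    measurable_fst.comp (measurable_snd.comp measurable_snd)
  have hρ : ∀ k, Measurable fun ω : DrivingSpace => ρ ω k := fun k =>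
    (measurable_coord k 0).comp h3
  have hρ' : ∀ k, Measurable fun ω : DrivingSpace => ρ' ω k := fun k =>
    (measurable_coord k 1).comp h3
  have hη : ∀ k, Measurable fun ω : DrivingSpace => η ω k := fun k =>
    (measurable_coord k 2).comp h3
  have hζ : ∀ e, Measurable fun ω : DrivingSpace => ζ ω e := fun e =>
    measurable_toNNReal.comp ((measurable_pi_apply e).comp
      (measurable_snd.comp (measurable_snd.comp measurable_snd)))
  have hG : ∀ i j, Measurable fun ω => graphonEvent 𝓦 ω i j := fun i j =>
    ((measurable_isPoint i).comp measurable_fst).and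
      (((measurable_isPoint j).comp measurable_fst).and
        ((hζ _).le' (𝓦.measurable_W.comp ((hϑ i).prodMk (hϑ j)))))
  have hS : ∀ j k, Measurable fun ω => starEvent 𝓦 ω j k := fun j k =>
    ((measurable_isPoint j).comp measurable_fst).and
      (((measurable_isPoint k).comp (hs j)).and ((hχ j k).le' (𝓦.measurable_S.comp (hϑ j))))
  have hI : ∀ k, Measurable fun ω => isoEvent 𝓦 ω k := fun k =>
    ((measurable_isPoint k).comp h3).and ((hη k).le' measurable_const)
  let K := (PointIndex 2 × PointIndex 2) ⊕ (PointIndex 2 × PointIndex 2) ⊕ PointIndex 3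
  let C : K → DrivingSpace → Prop := fun k ω =>
    Sum.elim (fun p => graphonEvent 𝓦 ω p.1 p.2)
      (Sum.elim (fun p => starEvent 𝓦 ω p.1 p.2) (fun k => isoEvent 𝓦 ω k)) k
  let X : K → DrivingSpace → ℝ≥0 := fun k ω =>
    Sum.elim (fun p => θ ω p.1) (Sum.elim (fun p => θ ω p.1) (fun k => ρ ω k)) k
  let Y : K → DrivingSpace → ℝ≥0 := fun k ω =>
    Sum.elim (fun p => θ ω p.2) (Sum.elim (fun p => σ ω p.1 p.2) (fun k => ρ' ω k)) k
  have hC : ∀ k, Measurable (C k) := by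
    rintro (p | p | k)
    exacts [hG _ _, hS _ _, hI _]
  have hX : ∀ k, Measurable (X k) := by
    rintro (p | p | k)
    exacts [hθ _, hθ _, hρ _]
  have hY : ∀ k, Measurable (Y k) := by
    rintro (p | p | k)
    exacts [hθ _, hσ _ _, hρ' _]
  have hatom : ∀ ω u v, (adjacencyMeasure 𝓦 ω {(u, v)} ≠ 0 ∨ adjacencyMeasure 𝓦 ω {(v, u)} ≠ 0) ↔
      ∃ k, C k ω ∧ ((X k ω = u ∧ Y k ω = v) ∨ (Y k ω = u ∧ X k ω = v)) := by
    intro ω u v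
    have h1 : ∀ a b, adjacencyMeasure 𝓦 ω {(a, b)} ≠ 0 ↔
        ((∃ p : PointIndex 2 × PointIndex 2, graphonEvent 𝓦 ω p.1 p.2 ∧
          θ ω p.1 = a ∧ θ ω p.2 = b) ∨
        (∃ p : PointIndex 2 × PointIndex 2, starEvent 𝓦 ω p.1 p.2 ∧
          ((θ ω p.1 = a ∧ σ ω p.1 p.2 = b) ∨ (σ ω p.1 p.2 = a ∧ θ ω p.1 = b)))) ∨
        (∃ k, isoEvent 𝓦 ω k ∧ ((ρ ω k = a ∧ ρ' ω k = b) ∨ (ρ' ω k = a ∧ ρ ω k = b))) := by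
      intro a b
      have hd : ∀ q : ℝ≥0 × ℝ≥0, Measure.dirac q {(a, b)} ≠ 0 ↔ q.1 = a ∧ q.2 = b := by
        intro q
        rw [Measure.dirac_apply' _ (measurableSet_singleton _)]
        simp [Set.indicator_apply, Prod.ext_iff]
      have hsum : ∀ {ι : Type} [Countable ι] (μ : ι → Measure (ℝ≥0 × ℝ≥0)),
          Measure.sum μ {(a, b)} ≠ 0 ↔ ∃ i, μ i {(a, b)} ≠ 0 := by
        intro ι _ μ
        rw [Ne, Measure.sum_apply_eq_zero]
        push Not
        rfl
      have hadd : ∀ μ ν : Measure (ℝ≥0 × ℝ≥0), (μ + ν) {(a, b)} ≠ 0 ↔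
          μ {(a, b)} ≠ 0 ∨ ν {(a, b)} ≠ 0 := by
        intro μ ν
        rw [Measure.add_apply, Ne, add_eq_zero, not_and_or]
      have hite : ∀ (P : Prop) [Decidable P] (μ : Measure (ℝ≥0 × ℝ≥0)),
          (if P then μ else 0) {(a, b)} ≠ 0 ↔ P ∧ μ {(a, b)} ≠ 0 := by
        intro P _ μ
        by_cases h : P <;> simp [h]
      rw [adjacencyMeasure, hadd, hadd, hsum, hsum, hsum]
      simp only [hite, hadd, hd]
    rw [h1, h1]
    constructor
    · rintro (((⟨p, hp, h⟩ | ⟨p, hp, h⟩) | ⟨k, hp, h⟩) | ((⟨p, hp, h⟩ | ⟨p, hp, h⟩) | ⟨k, hp, h⟩))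
      · exact ⟨Sum.inl p, hp, Or.inl h⟩
      · exact ⟨Sum.inr (Sum.inl p), hp, h⟩
      · exact ⟨Sum.inr (Sum.inr k), hp, h⟩
      · exact ⟨Sum.inl p, hp, Or.inr h.symm⟩
      · exact ⟨Sum.inr (Sum.inl p), hp, h.symm.imp And.symm And.symm⟩
      · exact ⟨Sum.inr (Sum.inr k), hp, h.symm.imp And.symm And.symm⟩
    · rintro ⟨p | p | k, hp, h⟩
      · rcases h with h | h
        · exact Or.inl (Or.inl (Or.inl ⟨p, hp, h⟩))
        · exact Or.inr (Or.inl (Or.inl ⟨p, hp, h.symm⟩))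
      · exact Or.inl (Or.inl (Or.inr ⟨p, hp, h⟩))
      · exact Or.inl (Or.inr ⟨k, hp, h⟩)
  have hres : ∀ (ω : DrivingSpace) (u v : ℝ≥0),
      ((adjacencyMeasure 𝓦 ω).restrict (Set.Icc 0 s ×ˢ Set.Icc 0 s)) {(u, v)} ≠ 0 ↔
        adjacencyMeasure 𝓦 ω {(u, v)} ≠ 0 ∧ u ≤ s ∧ v ≤ s := by
    intro ω u v
    rw [Measure.restrict_apply (measurableSet_singleton _)]
    by_cases h : u ≤ s ∧ v ≤ s
    · have : ({(u, v)} : Set (ℝ≥0 × ℝ≥0)) ∩ Set.Icc 0 s ×ˢ Set.Icc 0 s = {(u, v)} :=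
        Set.inter_eq_left.2 (by simpa using h)
      rw [this]
      exact ⟨fun h' => ⟨h', h⟩, fun h' => h'.1⟩
    · have : ({(u, v)} : Set (ℝ≥0 × ℝ≥0)) ∩ Set.Icc 0 s ×ˢ Set.Icc 0 s = ∅ := by
        rw [Set.singleton_inter_eq_empty]
        simpa using h
      rw [this, measure_empty]
      exact ⟨fun h' => absurd rfl h', fun h' => absurd h'.2 h⟩
  refine measurable_unlabel (K := K × Bool)
    (fun k ω => C k.1 ω ∧ X k.1 ω ≤ s ∧ Y k.1 ω ≤ s)
    (fun k ω => if k.2 then X k.1 ω else Y k.1 ω) (fun k ω => if k.2 then Y k.1 ω else X k.1 ω)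
    (fun k => (hC _).and (((hX _).le' measurable_const).and ((hY _).le' measurable_const)))
    ?_ ?_ _ ?_
  · rintro ⟨k, _ | _⟩
    exacts [hY k, hX k]
  · rintro ⟨k, _ | _⟩
    exacts [hX k, hY k]
  · intro ω u v
    have hadj : (graphexProcess 𝓦 s ω).Adj u v ↔
        (∃ k, C k ω ∧ ((X k ω = u ∧ Y k ω = v) ∨ (Y k ω = u ∧ X k ω = v))) ∧ u ≤ s ∧ v ≤ s := by
      rw [← hatom]
      show (_ ≠ 0 ∨ _ ≠ 0) ↔ _
      rw [hres, hres, and_comm (a := v ≤ s), ← or_and_right]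
    rw [hadj]
    constructor
    · rintro ⟨⟨k, hk, ⟨rfl, rfl⟩ | ⟨rfl, rfl⟩⟩, hu, hv⟩
      · exact ⟨(k, true), ⟨hk, hu, hv⟩, rfl, rfl⟩
      · exact ⟨(k, false), ⟨hk, hv, hu⟩, rfl, rfl⟩
    · rintro ⟨⟨k, _ | _⟩, ⟨hk, hu, hv⟩, rfl, rfl⟩
      · exact ⟨⟨k, hk, Or.inr ⟨rfl, rfl⟩⟩, hv, hu⟩
      · exact ⟨⟨k, hk, Or.inl ⟨rfl, rfl⟩⟩, hu, hv⟩

/-- The unlabeled graphex process distribution `GPD(𝓦, s)`: the law of the unlabeled graph of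
`Γ_s`. -/
def GPD (𝓦 : Graphex) (s : ℝ≥0) : ProbabilityMeasure UnlabeledGraph :=
  ⟨drivingLaw.map fun ω => (graphexProcess 𝓦 s ω).unlabel,
    Measure.isProbabilityMeasure_map (measurable_unlabel_graphexProcess 𝓦 s).aemeasurable⟩

/-- `G_1, G_2, …` is sampling convergent to the graphex `𝓦`. -/
def SamplingConvergent {n : ℕ → ℕ} (G : ∀ j, LoopGraph (Fin (n j))) (𝓦 : Graphex) : Prop :=
  ∀ s : ℝ≥0, Tendsto (fun j => sampD (G j) s) atTop (𝓝 (GPD 𝓦 s))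

/-! ### The stretched canonical graphon of a graph -/

open Classical in
/-- The empirical graphon of a graph with `n` vertices: `[0, 1)²` is divided into an `n × n` grid,
and the square `(i, j)` has value `1` if `(i, j)` is an edge and `0` otherwise. The function is
extended by `0` to `[0, ∞)²`. -/
def empGraphon {n : ℕ} (G : LoopGraph (Fin n)) (x y : ℝ≥0) : ℝ≥0 :=
  if ∃ i j : Fin n, G.Adj i j ∧
      x ∈ Set.Ico ((i : ℕ) / (n : ℝ≥0)) (((i : ℕ) + 1) / (n : ℝ≥0)) ∧
      y ∈ Set.Ico ((j : ℕ) / (n : ℝ≥0)) (((j : ℕ) + 1) / (n : ℝ≥0)) then 1 else 0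

/-- The factor `‖W^G‖₁^{1/2}`. -/
def stretch {n : ℕ} (G : LoopGraph (Fin n)) : ℝ≥0 := NNReal.sqrt (l1Norm (empGraphon G)).toNNReal

/-- The stretched canonical graphon `W^{G,s}`. -/
def strGraphon {n : ℕ} (G : LoopGraph (Fin n)) (x y : ℝ≥0) : ℝ≥0 :=
  if x < (stretch G)⁻¹ ∧ y < (stretch G)⁻¹ then empGraphon G (stretch G * x) (stretch G * y) else 0

theorem measurable_empGraphon {n : ℕ} (G : LoopGraph (Fin n)) :
    Measurable (Function.uncurry (empGraphon G)) := by
  refine Measurable.ite ?_ measurable_const measurable_const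
  rw [measurableSet_setOfPred]
  refine Measurable.exists fun i => Measurable.exists fun j => measurable_const.and ?_
  exact (measurableSet_setOfPred.1 (measurable_fst measurableSet_Ico)).and
    (measurableSet_setOfPred.1 (measurable_snd measurableSet_Ico))

theorem empGraphon_le_one {n : ℕ} (G : LoopGraph (Fin n)) (x y : ℝ≥0) : empGraphon G x y ≤ 1 := by
  unfold empGraphon
  split_ifs <;> simp

theorem empGraphon_symm {n : ℕ} (G : LoopGraph (Fin n)) (x y : ℝ≥0) :
    empGraphon G x y = empGraphon G y x := by
  unfold empGraphon
  congr 1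
  apply propext
  constructor
  · rintro ⟨i, j, h, hx, hy⟩
    exact ⟨j, i, G.symm _ _ h, hy, hx⟩
  · rintro ⟨i, j, h, hx, hy⟩
    exact ⟨j, i, G.symm _ _ h, hy, hx⟩

theorem measurable_strGraphon {n : ℕ} (G : LoopGraph (Fin n)) :
    Measurable (Function.uncurry (strGraphon G)) := by
  refine Measurable.ite ?_ ?_ measurable_const
  · rw [measurableSet_setOfPred]
    exact (measurable_fst.lt measurable_const).and (measurable_snd.lt measurable_const)
  · exact (measurable_empGraphon G).comp
      ((measurable_fst.const_mul _).prodMk (measurable_snd.const_mul _))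

/-- A bound by the indicator of `[0, c)²`. -/
theorem strGraphon_le {n : ℕ} (G : LoopGraph (Fin n)) (x y : ℝ≥0) :
    (strGraphon G x y : ℝ≥0∞) ≤ (Set.Iio (stretch G)⁻¹).indicator
      (fun _ => (Set.Iio (stretch G)⁻¹).indicator (fun _ => 1) y) x := by
  unfold strGraphon
  split_ifs with h
  · rw [Set.indicator_of_mem (show x ∈ Set.Iio _ from h.1),
      Set.indicator_of_mem (show y ∈ Set.Iio _ from h.2)]
    exact_mod_cast empGraphon_le_one G _ _
  · simp

theorem strGraphon_le_one {n : ℕ} (G : LoopGraph (Fin n)) (x y : ℝ≥0) :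
    strGraphon G x y ≤ 1 := by
  unfold strGraphon
  split_ifs
  · exact empGraphon_le_one G _ _
  · simp

theorem lintegral_strGraphon_le {n : ℕ} (G : LoopGraph (Fin n)) (x : ℝ≥0) :
    ∫⁻ y, strGraphon G x y ∂leb ≤
      (Set.Iio (stretch G)⁻¹).indicator (fun _ => (((stretch G)⁻¹ : ℝ≥0) : ℝ≥0∞)) x := by
  refine (lintegral_mono fun y => strGraphon_le G x y).trans ?_
  by_cases hx : x ∈ Set.Iio (stretch G)⁻¹
  · simp only [Set.indicator_of_mem hx]
    rw [lintegral_indicator_const measurableSet_Iio, leb_Iio, one_mul]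
  · simp only [Set.indicator_of_notMem hx, lintegral_zero, le_refl]

theorem strGraphon_symm {n : ℕ} (G : LoopGraph (Fin n)) (x y : ℝ≥0) :
    strGraphon G x y = strGraphon G y x := by
  unfold strGraphon
  simp only [empGraphon_symm G (stretch G * x), and_comm (a := x < _)]

theorem marginal_strGraphon_le {n : ℕ} (G : LoopGraph (Fin n)) (y : ℝ≥0) :
    marginal (strGraphon G) y ≤
      (Set.Iio (stretch G)⁻¹).indicator (fun _ => (((stretch G)⁻¹ : ℝ≥0) : ℝ≥0∞)) y := by
  unfold marginal
  simp_rw [fun x => strGraphon_symm G x y]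
  exact lintegral_strGraphon_le G y

theorem l1Norm_strGraphon_lt_top {n : ℕ} (G : LoopGraph (Fin n)) :
    l1Norm (strGraphon G) < ∞ := by
  refine (lintegral_mono fun x => lintegral_strGraphon_le G x).trans_lt ?_
  rw [lintegral_indicator_const measurableSet_Iio, leb_Iio]
  exact ENNReal.mul_lt_top ENNReal.coe_lt_top ENNReal.coe_lt_top

/-- The stretched canonical graphon, as the graphex `(0, 0, W^{G,s})`. -/
def strGraphex {n : ℕ} (G : LoopGraph (Fin n)) : Graphex where
  I := 0
  S := fun _ => 0
  W := strGraphon G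
  measurable_S := measurable_const
  integrable_S := by simp
  measurable_W := measurable_strGraphon G
  W_le_one := strGraphon_le_one G
  W_symm := strGraphon_symm G
  marginal_ne_top := by
    have : {x | marginal (strGraphon G) x = ∞} = ∅ := by
      rw [Set.eq_empty_iff_forall_notMem]
      intro x hx
      have h := marginal_strGraphon_le G x
      rw [show marginal (strGraphon G) x = ∞ from hx] at h
      by_cases h' : x ∈ Set.Iio (stretch G)⁻¹
      · rw [Set.indicator_of_mem h'] at h
        exact ENNReal.coe_ne_top (top_le_iff.1 h)
      · rw [Set.indicator_of_notMem h'] at h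
        exact ENNReal.zero_ne_top (top_le_iff.1 h)
    rw [this, measure_empty]
  marginal_gt_one := by
    have : {x | 1 < marginal (strGraphon G) x} ⊆ Set.Iio (stretch G)⁻¹ := by
      intro x hx
      by_contra h'
      have h := marginal_strGraphon_le G x
      rw [Set.indicator_of_notMem h'] at h
      exact absurd (lt_of_lt_of_le (show 1 < marginal (strGraphon G) x from hx) h) (by simp)
    refine (measure_mono this).trans_lt ?_
    rw [leb_Iio]
    exact ENNReal.coe_lt_top
  integrable_W := by
    refine lt_of_le_of_lt (lintegral_mono fun x => lintegral_mono fun y => ?_)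
      (l1Norm_strGraphon_lt_top G)
    dsimp only
    split_ifs
    · exact le_rfl
    · exact bot_le
  integrable_diag := by
    refine lt_of_le_of_lt (lintegral_mono fun x => (strGraphon_le G x x).trans
      (?_ : _ ≤ (Set.Iio (stretch G)⁻¹).indicator (fun _ => (1 : ℝ≥0∞)) x)) ?_
    · by_cases h : x ∈ Set.Iio (stretch G)⁻¹
      · simp only [Set.indicator_of_mem h, le_refl]
      · simp only [Set.indicator_of_notMem h, le_refl]
    · rw [lintegral_indicator_const measurableSet_Iio, leb_Iio, one_mul]
      exact ENNReal.coe_lt_top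

end

end GraphexSampling

open GraphexSampling

/-!
Write `e` for the number of non-loop edges of a graph `G` and `ℓ` for its number of loops. Both laws
are laws of *random blow-ups* of `G`: every vertex is replaced by a random number of clones, the
numbers being independent and identically distributed, and isolated vertices are discarded.

* For `Smpl(G, r)` the multiplicities are Bernoulli with mean `p = min (r / √(2 e)) 1`
  (`sampling_eq_blowupLaw`).
* `‖W^G‖₁ = (2 e + ℓ) / v²` for a graph with `v` vertices, so in the stretched graphon every vertex
  occupies an interval of length `1 / √(2 e + ℓ)`. The clones of a vertex in `GPD(W^{G,s}, r)` are
  the Poisson points in a rectangle with sides `r` and `1 / √(2 e + ℓ)`; hence the multiplicities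
  are Poisson with mean `q = r / √(2 e + ℓ)` (`GPD_strGraphex_eq_blowupLaw`). That the numbers of
  points in disjoint rectangles are independent Poisson variables is `map_count_poissonLaw`, proved
  with characteristic functions from the construction of the process cube by cube.

As `q ≤ p`, the two kinds of multiplicities `N` and `B` can be coupled so that `N ≠ 0` implies
`B = 1` and so that `N = B` up to probability `p - q + q ^ 2`
(`exists_poisson_bernoulli_coupling`). The two graphs differ only if some edge `ij` has `N i ≠ B i`
and `B j ≠ 0`, or some loop sits at a vertex `i` with `N i ≠ B i`; by the union bound the total
variation distance is at most `(2 e p + ℓ) (p - q + q ^ 2)` up to a constant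
(`abs_integral_blowupLaw_sub_le`). If `ℓ = O(√e)`, this is `O(1 / √e)`, and the two sequences of
laws have the same limits (`tendsto_sampD_iff_tendsto_GPD`).

The bound `ℓ = O(√e)` follows from either of the two kinds of convergence: the number `L` of loops
of the blow-up has `𝔼 2 ^ (-L) ≤ exp (-ℓ q / 2)`, or the same with `p`, and this expectation
converges to a positive limit (`exists_bound_of_tendsto`).
-/

namespace GraphexSampling

noncomputable section

/-! ### Blow-ups and loop counts of graphs -/

namespace LoopGraph

variable {U V : Type*}

/-- The unlabeled graph depends only on the graph up to relabelling and isolated vertices. -/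
theorem unlabel_eq_of_injective (G : LoopGraph U) (H : LoopGraph V) (f : U → V)
    (hf : Function.Injective f) (hadj : ∀ x y, G.Adj x y ↔ H.Adj (f x) (f y))
    (hr : H.support ⊆ Set.range f) : G.unlabel = H.unlabel := by
  have himg : f '' G.support = H.support := by
    ext v
    constructor
    · rintro ⟨x, ⟨y, hy⟩, rfl⟩
      exact ⟨f y, (hadj _ _).1 hy⟩
    · intro hv
      obtain ⟨x, rfl⟩ := hr hv
      obtain ⟨w, hw⟩ := hv
      obtain ⟨y, rfl⟩ := hr ⟨f x, H.symm _ _ hw⟩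
      exact ⟨x, ⟨y, (hadj _ _).2 hw⟩, rfl⟩
  have hfin : Finite G.support ↔ Finite H.support := by
    rw [← himg]
    exact (Set.finite_image_iff hf.injOn).symm
  by_cases h : Finite G.support
  · obtain ⟨n, K, hK⟩ := UnlabeledGraph.exists_eq_mk G.unlabel
    obtain ⟨g, hg, hgadj, hgr⟩ := (exists_embedding_iff G n K).2 ⟨h, hK⟩
    rw [hK]
    refine ((exists_embedding_iff H n K).1 ⟨f ∘ g, hf.comp hg, fun a b => ?_, ?_⟩).2.symm
    · rw [hgadj, hadj]
      rfl
    · rw [Set.range_comp, hgr, himg]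
  · rw [unlabel, dif_neg h, unlabel, dif_neg (fun h' => h (hfin.2 h'))]

/-- The blow-up of `G` in which the vertex `v` is replaced by `N v` clones `(v, 0), (v, 1), …`. The
vertices `(v, k)` with `k ≥ N v` are present but isolated, so that the vertex set does not depend
on `N`. -/
def blowup (G : LoopGraph V) (N : V → ℕ) : LoopGraph (V × ℕ) where
  Adj x y := G.Adj x.1 y.1 ∧ x.2 < N x.1 ∧ y.2 < N y.1
  symm _ _ h := ⟨G.symm _ _ h.1, h.2.2, h.2.1⟩

/-- Up to isolated vertices, a graph pulled back along a map with finite fibres is a blow-up, with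
the cardinalities of the fibres as multiplicities. -/
theorem unlabel_comap_eq_blowup (G : LoopGraph V) (N : V → ℕ) {J : Type*} [Finite J] (k : J → V)
    (hk : ∀ v, Nat.card {j // k j = v} = N v) : (G.comap k).unlabel = (G.blowup N).unlabel := by
  let e : ∀ v, {j // k j = v} ≃ Fin (N v) := fun v => Finite.equivFinOfCardEq (hk v)
  refine unlabel_eq_of_injective _ _ (fun j => (k j, (e (k j) ⟨j, rfl⟩ : ℕ))) ?_ ?_ ?_
  · intro j j' h
    rw [Prod.mk.injEq] at h
    obtain ⟨h1, h2⟩ := h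
    have : ∀ v (hv : k j = v), (e v ⟨j, hv⟩ : ℕ) = (e (k j) ⟨j, rfl⟩ : ℕ) := by
      rintro v rfl
      rfl
    rw [← this _ h1] at h2
    exact congrArg Subtype.val ((e _).injective (Fin.ext h2))
  · intro x y
    simp [comap, blowup]
  · rintro ⟨v, a⟩ ⟨w, h, ha, -⟩
    obtain ⟨⟨j, rfl⟩, hj⟩ := (e v).surjective ⟨a, ha⟩
    exact ⟨j, by simp [hj]⟩

open Classical in
theorem unlabel_induce_eq_blowup [Finite V] (G : LoopGraph V) (s : Set V) :
    (G.induce s).unlabel = (G.blowup fun v => if v ∈ s then 1 else 0).unlabel := by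
  refine unlabel_comap_eq_blowup G _ Subtype.val fun v => ?_
  split_ifs with h
  · have : Unique {j : s // (j : V) = v} :=
      ⟨⟨⟨⟨v, h⟩, rfl⟩⟩, fun j => Subtype.ext (Subtype.ext j.2)⟩
    exact Nat.card_unique
  · have : IsEmpty {j : s // (j : V) = v} := ⟨fun j => h (j.2 ▸ j.1.2)⟩
    exact Nat.card_of_isEmpty

theorem finite_support_blowup [Finite V] (G : LoopGraph V) (N : V → ℕ) :
    Finite (G.blowup N).support := by
  have : (G.blowup N).support ⊆ ⋃ v : V, (fun a => (v, a)) '' Set.Iio (N v) := by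
    rintro ⟨v, a⟩ ⟨w, -, ha, -⟩
    exact Set.mem_iUnion.2 ⟨v, a, ha, rfl⟩
  exact Set.Finite.subset (Set.finite_iUnion fun v => (Set.finite_Iio _).image _) this

/-- The number of loops. -/
def numLoops (G : LoopGraph V) : ℕ := {x | G.Adj x x}.ncard

open Classical in
theorem numLoops_blowup [Fintype V] (G : LoopGraph V) (N : V → ℕ) :
    (G.blowup N).numLoops = ∑ v, if G.Adj v v then N v else 0 := by
  have : {x | (G.blowup N).Adj x x} =
      ↑(((Finset.univ.filter fun v => G.Adj v v).sigma fun v => Finset.range (N v)).map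
        (Equiv.sigmaEquivProd V ℕ).toEmbedding) := by
    ext ⟨v, a⟩
    simp [blowup]
  rw [numLoops, this, Set.ncard_coe_finset, Finset.card_map, Finset.card_sigma, Finset.sum_filter]
  simp

open Classical in
/-- Ordered adjacent pairs of distinct vertices count every edge twice. -/
theorem card_filter_adj_ne [Fintype V] (G : LoopGraph V) :
    (Finset.univ.filter fun p : V × V => G.Adj p.1 p.2 ∧ p.1 ≠ p.2).card = 2 * G.numEdges := by
  let S : SimpleGraph V := SimpleGraph.mk (fun x y => G.Adj x y ∧ x ≠ y)
    ⟨fun x y h => ⟨G.symm _ _ h.1, h.2.symm⟩⟩ ⟨fun x h => h.2 rfl⟩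
  have hE : S.edgeFinset.card = G.numEdges := by
    rw [numEdges, ← Set.ncard_coe_finset]
    congr 1
    ext e
    induction e with | _ x y => ?_
    simp only [SimpleGraph.coe_edgeFinset, SimpleGraph.mem_edgeSet, Set.mem_ofPred_eq,
      Sym2.mk_isDiag_iff, edgeSet]
    constructor
    · rintro ⟨h, h'⟩
      exact ⟨⟨x, y, h, rfl⟩, h'⟩
    · rintro ⟨⟨a, b, h, h'⟩, hne⟩
      rcases Sym2.eq_iff.1 h' with ⟨rfl, rfl⟩ | ⟨rfl, rfl⟩
      · exact ⟨h, hne⟩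
      · exact ⟨G.symm _ _ h, hne⟩
  rw [← hE, ← S.sum_degrees_eq_twice_card_edges]
  rw [← Finset.univ_product_univ, Finset.card_filter, Finset.sum_product]
  refine Finset.sum_congr rfl fun v _ => ?_
  rw [← SimpleGraph.card_neighborFinset_eq_degree, ← Finset.card_filter]
  congr 1
  ext w
  simp [S]

open Classical in
theorem card_filter_adj [Fintype V] (G : LoopGraph V) :
    (Finset.univ.filter fun p : V × V => G.Adj p.1 p.2).card = 2 * G.numEdges + G.numLoops := by
  rw [← card_filter_adj_ne, ← Finset.card_filter_add_card_filter_not (fun p : V × V => p.1 ≠ p.2),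
    Finset.filter_filter, Finset.filter_filter]
  congr 1
  have : {x | G.Adj x x} = ↑(Finset.univ.filter fun x => G.Adj x x) := by simp
  rw [numLoops, this, Set.ncard_coe_finset]
  symm
  refine Finset.card_bij (fun x _ => (x, x)) (by simp) (by simp) ?_
  rintro ⟨x, y⟩ h
  simp only [Finset.mem_filter, Finset.mem_univ, true_and, not_not] at h
  obtain ⟨h, rfl⟩ := h
  exact ⟨x, by simpa using h, rfl⟩

end LoopGraph

/-- The number of loops of an unlabeled graph. -/
def UnlabeledGraph.numLoops (q : UnlabeledGraph) : ℕ :=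
  Quotient.lift (s := graphSetoid) (fun G => G.2.numLoops) (by
    rintro ⟨n, G⟩ ⟨m, H⟩ ⟨e⟩
    have : {x | H.Adj x x} = e '' {x | G.Adj x x} := by
      ext x
      constructor
      · intro h
        refine ⟨e.symm x, ?_, e.apply_symm_apply x⟩
        exact e.map_rel_iff.1 (by simpa using h)
      · rintro ⟨y, hy, rfl⟩
        exact e.map_rel_iff.2 hy
    show G.numLoops = H.numLoops
    rw [LoopGraph.numLoops, LoopGraph.numLoops, this, Set.ncard_image_of_injective _ e.injective]) q

theorem LoopGraph.numLoops_unlabel {V : Type*} (G : LoopGraph V) (h : Finite G.support) :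
    G.unlabel.numLoops = G.numLoops := by
  obtain ⟨n, K, hK⟩ := UnlabeledGraph.exists_eq_mk G.unlabel
  obtain ⟨g, hg, hgadj, hgr⟩ := (exists_embedding_iff G n K).2 ⟨h, hK⟩
  have : {x | G.Adj x x} = g '' {x | K.Adj x x} := by
    ext x
    constructor
    · intro hx
      obtain ⟨a, rfl⟩ : x ∈ Set.range g := hgr ▸ (⟨x, hx⟩ : x ∈ G.support)
      exact ⟨a, (hgadj _ _).2 hx, rfl⟩
    · rintro ⟨a, ha, rfl⟩
      exact (hgadj _ _).1 ha
  rw [hK, numLoops, this, Set.ncard_image_of_injective _ hg]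
  rfl

/-! ### Random blow-ups -/

/-- The law of the unlabeled blow-up of `G` whose multiplicities are independent with law `ν`. -/
def blowupLaw {n : ℕ} (G : LoopGraph (Fin n)) (ν : Measure ℕ) : Measure UnlabeledGraph :=
  (Measure.pi fun _ : Fin n => ν).map fun N => (G.blowup N).unlabel

theorem blowupLaw_map {n : ℕ} (G : LoopGraph (Fin n)) {α : Type*} [MeasurableSpace α]
    (κ : Measure α) [IsProbabilityMeasure κ] {f : α → ℕ} (hf : Measurable f) :
    blowupLaw G (κ.map f) =
      (Measure.pi fun _ : Fin n => κ).map fun x => (G.blowup fun i => f (x i)).unlabel := by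
  have : IsProbabilityMeasure (κ.map f) := Measure.isProbabilityMeasure_map hf.aemeasurable
  rw [blowupLaw, ← Measure.pi_map_pi (fun _ => hf.aemeasurable),
    Measure.map_map (measurable_of_countable _) (by fun_prop)]
  rfl

/-- The Bernoulli law with parameter `p ≤ 1` on `{0, 1} ⊆ ℕ`. -/
def bernoulliNat (p : ℝ≥0) : Measure ℕ := p • Measure.dirac 1 + (1 - p) • Measure.dirac 0

theorem bernoulliNat_apply (p : ℝ≥0) (s : Set ℕ) :
    bernoulliNat p s = p * s.indicator 1 1 + ((1 - p : ℝ≥0) : ℝ≥0∞) * s.indicator 1 0 := by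
  rw [bernoulliNat, Measure.add_apply, Measure.smul_apply, Measure.smul_apply,
    Measure.dirac_apply, Measure.dirac_apply]
  rfl

theorem isProbabilityMeasure_bernoulliNat {p : ℝ≥0} (hp : p ≤ 1) :
    IsProbabilityMeasure (bernoulliNat p) := by
  constructor
  rw [bernoulliNat_apply]
  simpa using add_tsub_cancel_of_le (ENNReal.coe_le_one_iff.2 hp)

/-- Sampling the vertices of a graph is a blow-up with Bernoulli multiplicities. -/
theorem sampling_eq_blowupLaw {n : ℕ} (G : LoopGraph (Fin n)) (p : ℝ≥0) :
    (sampling G p : Measure UnlabeledGraph) = blowupLaw G (bernoulliNat (min p 1)) := by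
  classical
  set P : unitInterval := ⟨min (p : ℝ) 1, le_min p.2 zero_le_one, min_le_right _ _⟩ with hP
  have h1 : unitInterval.toNNReal P = min p 1 := by
    ext
    simp [hP]
  have h2 : unitInterval.toNNReal (unitInterval.symm P) = 1 - min p 1 := by
    ext
    rw [NNReal.coe_sub (min_le_right _ _)]
    simp [hP]
  set β : Measure Prop := unitInterval.toNNReal P • Measure.dirac True +
    unitInterval.toNNReal (unitInterval.symm P) • Measure.dirac False with hβ
  have hβp : IsProbabilityMeasure β := by
    constructor
    simp [hβ, h1, h2, ENNReal.smul_def]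
  have hmap : β.map (fun b : Prop => if b then 1 else 0) = bernoulliNat (min p 1) := by
    rw [hβ, Measure.map_add _ _ (measurable_of_countable _), Measure.map_smul, Measure.map_smul,
      Measure.map_dirac' (measurable_of_countable _), Measure.map_dirac' (measurable_of_countable _),
      h1, h2, bernoulliNat]
    simp
  show (setBernoulli Set.univ P).map _ = _
  rw [setBernoulli_eq_map, Measure.map_map (measurable_of_countable _) (measurable_of_countable _)]
  simp only [Set.mem_univ]
  rw [Measure.infinitePi_eq_pi, ← hmap, blowupLaw_map G β (measurable_of_countable _)]
  congr 1
  funext s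
  exact LoopGraph.unlabel_induce_eq_blowup G _

/-- The generating function of the number of loops of a random blow-up. -/
theorem integral_two_inv_pow_numLoops {n : ℕ} (G : LoopGraph (Fin n)) (ν : Measure ℕ)
    [IsProbabilityMeasure ν] :
    ∫ q, (1 / 2 : ℝ) ^ q.numLoops ∂(blowupLaw G ν) =
      (∫ k, (1 / 2 : ℝ) ^ k ∂ν) ^ G.numLoops := by
  classical
  rw [blowupLaw, integral_map (measurable_of_countable _).aemeasurable
    (measurable_of_countable _).aestronglyMeasurable]
  have h : ∀ N : Fin n → ℕ, (1 / 2 : ℝ) ^ (G.blowup N).unlabel.numLoops =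
      ∏ v, (fun k : ℕ => if G.Adj v v then (1 / 2 : ℝ) ^ k else 1) (N v) := by
    intro N
    rw [LoopGraph.numLoops_unlabel _ (G.finite_support_blowup N), LoopGraph.numLoops_blowup,
      ← Finset.prod_pow_eq_pow_sum]
    refine Finset.prod_congr rfl fun v _ => ?_
    split_ifs <;> simp
  simp_rw [h]
  rw [integral_fintype_prod_eq_prod (μ := fun _ => ν)
    (fun v k => if G.Adj v v then (1 / 2 : ℝ) ^ k else 1)]
  have h2 : ∀ v, ∫ k, (if G.Adj v v then (1 / 2 : ℝ) ^ k else 1) ∂ν =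
      if G.Adj v v then ∫ k, (1 / 2 : ℝ) ^ k ∂ν else 1 := by
    intro v
    split_ifs <;> simp
  simp_rw [h2]
  have : {x | G.Adj x x} = ↑(Finset.univ.filter fun x => G.Adj x x) := by simp
  rw [Finset.prod_ite, Finset.prod_const, Finset.prod_const_one, mul_one, LoopGraph.numLoops, this,
    Set.ncard_coe_finset]

theorem integral_two_inv_pow_bernoulliNat {p : ℝ≥0} (hp : p ≤ 1) :
    ∫ k, (1 / 2 : ℝ) ^ k ∂(bernoulliNat p) = 1 - p / 2 := by
  rw [bernoulliNat, integral_add_measure, integral_smul_nnreal_measure,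
    integral_smul_nnreal_measure, integral_dirac, integral_dirac, NNReal.smul_def, NNReal.smul_def,
    NNReal.coe_sub hp]
  · simp
    ring
  · exact (integrable_dirac (by simp)).smul_measure_nnreal
  · exact (integrable_dirac (by simp)).smul_measure_nnreal

theorem integral_two_inv_pow_poissonMeasure (q : ℝ≥0) :
    ∫ k, (1 / 2 : ℝ) ^ k ∂(poissonMeasure q) = Real.exp (-q / 2) := by
  rw [integral_poissonMeasure]
  have : ∀ k : ℕ, (Real.exp (-q) * (q : ℝ) ^ k / (k.factorial : ℝ)) • (1 / 2 : ℝ) ^ k =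
      Real.exp (-q) * ((q / 2 : ℝ) ^ k / k.factorial) := by
    intro k
    rw [smul_eq_mul, div_pow, div_pow, one_pow]
    ring
  simp_rw [this]
  rw [tsum_mul_left, (NormedSpace.expSeries_div_hasSum_exp (q / 2 : ℝ)).tsum_eq,
    ← Real.exp_eq_exp_ℝ, ← Real.exp_add]
  ring_nf

/-! ### Coupling Poisson and Bernoulli multiplicities -/

/-- For `q ≤ p ≤ 1`, a Poisson variable `N` of mean `q` and a Bernoulli variable `B` of mean `p` can
be coupled so that `B = 1` whenever `N ≠ 0`, and `N = B` up to probability `p - q + q ^ 2`. -/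
theorem exists_poisson_bernoulli_coupling {p q : ℝ≥0} (hqp : q ≤ p) (hp : p ≤ 1) :
    ∃ κ : Measure (ℕ × ℕ), IsProbabilityMeasure κ ∧ κ.map Prod.fst = poissonMeasure q ∧
      κ.map Prod.snd = bernoulliNat p ∧ (∀ᵐ x ∂κ, x.1 ≠ 0 → x.2 ≠ 0) ∧
      κ.real {x | x.1 ≠ x.2} ≤ p - q + q ^ 2 := by
  set w : ℝ≥0 := ⟨Real.exp (-q), (Real.exp_pos _).le⟩ with hw
  have hw0 : poissonMeasure q {0} = w := by
    rw [poissonMeasure_singleton]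
    simp only [pow_zero, mul_one, Nat.factorial_zero, Nat.cast_one, div_one]
    rw [ENNReal.ofReal, Real.toNNReal_of_nonneg (Real.exp_pos _).le]
    rfl
  have hwp : 1 - p ≤ w := by
    rw [← NNReal.coe_le_coe, NNReal.coe_sub hp]
    have := Real.add_one_le_exp (-(q : ℝ))
    have h : (q : ℝ) ≤ p := hqp
    show 1 - (p : ℝ) ≤ Real.exp (-q)
    linarith
  -- On `N ≠ 0` put `B = 1`; the mass `exp (-q)` of `N = 0` is split so that `B` has mean `p`.
  set κ₁ : Measure (ℕ × ℕ) := ((poissonMeasure q).restrict {0}ᶜ).map (fun k => (k, 1)) with hκ₁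
  set κ : Measure (ℕ × ℕ) := κ₁ + ((w - (1 - p)) • Measure.dirac (0, 1) +
    (1 - p) • Measure.dirac (0, 0)) with hκ
  have hfst : κ.map Prod.fst = poissonMeasure q := by
    rw [hκ, Measure.map_add _ _ measurable_fst, Measure.map_add _ _ measurable_fst,
      Measure.map_smul, Measure.map_smul,
      Measure.map_dirac' measurable_fst, Measure.map_dirac' measurable_fst, ← add_smul,
      tsub_add_cancel_of_le hwp, hκ₁, Measure.map_map measurable_fst (measurable_of_countable _)]
    have : Prod.fst ∘ (fun k : ℕ => (k, 1)) = (id : ℕ → ℕ) := rfl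
    rw [this, Measure.map_id]
    conv_rhs => rw [← Measure.restrict_add_restrict_compl (μ := poissonMeasure q)
      (measurableSet_singleton 0), Measure.restrict_singleton, hw0, add_comm]
    rfl
  have hprob : IsProbabilityMeasure κ := by
    constructor
    have : κ Set.univ = κ.map Prod.fst Set.univ := by
      rw [Measure.map_apply measurable_fst MeasurableSet.univ, Set.preimage_univ]
    rw [this, hfst, measure_univ]
  have hcompl : poissonMeasure q {0}ᶜ = ((1 - w : ℝ≥0) : ℝ≥0∞) := by
    rw [prob_compl_eq_one_sub (measurableSet_singleton 0), hw0, ENNReal.coe_sub]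
    rfl
  have hw1 : w ≤ 1 := by
    rw [← NNReal.coe_le_coe]
    exact Real.exp_le_one_iff.2 (by simp)
  have hsnd : κ.map Prod.snd = bernoulliNat p := by
    rw [hκ, Measure.map_add _ _ measurable_snd, Measure.map_add _ _ measurable_snd,
      Measure.map_smul, Measure.map_smul,
      Measure.map_dirac' measurable_snd, Measure.map_dirac' measurable_snd,
      hκ₁, Measure.map_map measurable_snd (measurable_of_countable _)]
    have : Prod.snd ∘ (fun k : ℕ => (k, 1)) = fun _ => 1 := rfl
    rw [this, Measure.map_const, Measure.restrict_apply_univ, hcompl, ← add_assoc, bernoulliNat]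
    congr 1
    rw [← ENNReal.smul_def, ← add_smul]
    congr 1
    rw [← NNReal.coe_inj]
    push_cast [NNReal.coe_sub hw1, NNReal.coe_sub hwp, NNReal.coe_sub hp]
    ring
  have hae : ∀ᵐ x ∂κ, x.1 ≠ 0 → x.2 = 1 := by
    rw [hκ, ae_add_measure_iff, ae_add_measure_iff]
    refine ⟨?_, Measure.ae_smul_measure ?_ _, Measure.ae_smul_measure ?_ _⟩
    · rw [hκ₁, ae_map_iff (measurable_of_countable _).aemeasurable
        (Set.to_countable _).measurableSet]
      exact Filter.Eventually.of_forall fun _ _ => rfl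
    · rw [ae_dirac_eq]
      simp
    · rw [ae_dirac_eq]
      simp
  refine ⟨κ, hprob, hfst, hsnd, ?_, ?_⟩
  · filter_upwards [hae] with x hx h
    rw [hx h]
    exact one_ne_zero
  · -- `N = B` on the disjoint events `B = 0` and `N = 1`.
    have hB : κ.real {x | x.2 = 0} = 1 - p := by
      have : κ.real {x | x.2 = 0} = (κ.map Prod.snd).real {0} := by
        rw [map_measureReal_apply measurable_snd (measurableSet_singleton 0)]
        rfl
      rw [this, hsnd, Measure.real, bernoulliNat_apply]
      simp [hp]
    have hN : κ.real {x | x.1 = 1} = Real.exp (-q) * q := by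
      have : κ.real {x | x.1 = 1} = (κ.map Prod.fst).real {1} := by
        rw [map_measureReal_apply measurable_fst (measurableSet_singleton 1)]
        rfl
      rw [this, hfst, poissonMeasure_real_singleton]
      simp
    have hdisj : κ.real ({x | x.2 = 0} ∪ {x | x.1 = 1}) = κ.real {x | x.2 = 0} +
        κ.real {x | x.1 = 1} := by
      refine measureReal_union₀ (Set.to_countable _).measurableSet.nullMeasurableSet ?_
      rw [AEDisjoint, measure_eq_zero_iff_ae_notMem]
      filter_upwards [hae] with x hx h
      have h1 : x.2 = 0 := h.1
      have h2 : x.1 = 1 := h.2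
      omega
    have hle : κ.real {x | x.1 ≠ x.2} ≤ κ.real ({x | x.2 = 0} ∪ {x | x.1 = 1})ᶜ := by
      refine ENNReal.toReal_mono (measure_ne_top _ _) (measure_mono_ae ?_)
      filter_upwards [hae] with x hx hne h
      have h1 : x.1 ≠ x.2 := hne
      have h2 : x.2 = 0 ∨ x.1 = 1 := h
      omega
    rw [probReal_compl_eq_one_sub (Set.to_countable _).measurableSet, hdisj, hB, hN] at hle
    have h1 := Real.add_one_le_exp (-(q : ℝ))
    have h2 : (0 : ℝ) ≤ q := q.2
    nlinarith

/-- Union bound over the edges and loops of `G`: two coupled blow-ups with multiplicities `N` and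
`B ≥ 1_{N ≠ 0}` differ only if there is an edge `ij` with `N i ≠ B i` and `B j ≠ 0`, or a loop at
some `i` with `N i ≠ B i`. -/
theorem measureReal_blowup_ne_le {n : ℕ} (G : LoopGraph (Fin n)) (κ : Measure (ℕ × ℕ))
    [IsProbabilityMeasure κ] (hκ : ∀ᵐ x ∂κ, x.1 ≠ 0 → x.2 ≠ 0) :
    (Measure.pi fun _ : Fin n => κ).real {x | (G.blowup fun i => (x i).1).unlabel ≠
        (G.blowup fun i => (x i).2).unlabel} ≤
      2 * G.numEdges * (κ.real {x | x.1 ≠ x.2} * κ.real {x | x.2 ≠ 0}) +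
        G.numLoops * κ.real {x | x.1 ≠ x.2} := by
  classical
  set P := Measure.pi fun _ : Fin n => κ with hP
  set D : Set (ℕ × ℕ) := {x | x.1 ≠ x.2}
  set E : Set (ℕ × ℕ) := {x | x.2 ≠ 0}
  have hD : MeasurableSet D := (Set.to_countable _).measurableSet
  have hE : MeasurableSet E := (Set.to_countable _).measurableSet
  have hmp : ∀ i : Fin n, MeasurePreserving (fun x : Fin n → ℕ × ℕ => x i) P κ :=
    fun i => measurePreserving_eval _ i
  have hae : ∀ᵐ x ∂P, ∀ i, (x i).1 ≠ 0 → (x i).2 ≠ 0 :=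
    ae_all_iff.2 fun i => (hmp i).quasiMeasurePreserving.ae hκ
  let A : Finset (Fin n × Fin n) := Finset.univ.filter fun p => G.Adj p.1 p.2 ∧ p.1 ≠ p.2
  let B : Finset (Fin n) := Finset.univ.filter fun i => G.Adj i i
  have hsub : P.real {x | (G.blowup fun i => (x i).1).unlabel ≠
      (G.blowup fun i => (x i).2).unlabel} ≤
      P.real ((⋃ p ∈ A, {x | x p.1 ∈ D} ∩ {x | x p.2 ∈ E}) ∪ ⋃ i ∈ B, {x | x i ∈ D}) := by
    refine ENNReal.toReal_mono (measure_ne_top _ _) (measure_mono_ae ?_)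
    filter_upwards [hae] with x hx hne
    by_contra hcon
    apply hne
    congr 1
    apply LoopGraph.adj_injective
    have hcon' : ∀ i j, G.Adj i j → (x j).2 ≠ 0 → (x i).1 = (x i).2 := by
      intro i j hij hj
      by_contra hi
      apply hcon
      by_cases h : i = j
      · subst h
        exact Or.inr (Set.mem_biUnion (show i ∈ (B : Set (Fin n)) by simpa [B] using hij) hi)
      · exact Or.inl (Set.mem_biUnion
          (show (i, j) ∈ (A : Set (Fin n × Fin n)) by simpa [A] using ⟨hij, h⟩) ⟨hi, hj⟩)
    funext a b
    apply propext
    constructor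
    · rintro ⟨h, ha, hb⟩
      have h1 := hcon' _ _ h (hx _ (Nat.ne_zero_of_lt hb))
      have h2 := hcon' _ _ (G.symm _ _ h) (hx _ (Nat.ne_zero_of_lt ha))
      exact ⟨h, by simpa only [h1] using ha, by simpa only [h2] using hb⟩
    · rintro ⟨h, ha, hb⟩
      have h1 := hcon' _ _ h (Nat.ne_zero_of_lt hb)
      have h2 := hcon' _ _ (G.symm _ _ h) (Nat.ne_zero_of_lt ha)
      exact ⟨h, by simpa only [h1] using ha, by simpa only [h2] using hb⟩
  have hev : ∀ (i : Fin n) (S : Set (ℕ × ℕ)), MeasurableSet S → P.real {x | x i ∈ S} = κ.real S :=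
    fun i S hS => (hmp i).measureReal_preimage hS.nullMeasurableSet
  have hind : iIndepFun (fun (i : Fin n) (x : Fin n → ℕ × ℕ) => x i) P :=
    iIndepFun_pi (X := fun _ => id) fun _ => aemeasurable_id
  refine hsub.trans ((measureReal_union_le _ _).trans (add_le_add ?_ ?_))
  · refine (measureReal_biUnion_finset_le _ _).trans ?_
    have h2 : ((A.card : ℕ) : ℝ) = 2 * G.numEdges := by
      have h3 : A.card = 2 * G.numEdges := by
        rw [← G.card_filter_adj_ne]
        congr!
      rw [h3]
      push_cast
      rfl
    rw [← h2, ← nsmul_eq_mul]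
    refine Finset.sum_le_card_nsmul _ _ _ fun p hp => le_of_eq ?_
    have hne : p.1 ≠ p.2 := by
      simp only [A, Finset.mem_filter] at hp
      exact hp.2.2
    have := IndepFun.measure_inter_preimage_eq_mul (hind.indepFun hne) _ _ hD hE
    rw [← hev p.1 D hD, ← hev p.2 E hE, Measure.real, Measure.real, Measure.real,
      ← ENNReal.toReal_mul]
    exact congrArg ENNReal.toReal this
  · refine (measureReal_biUnion_finset_le _ _).trans ?_
    have h2 : G.numLoops = B.card := by
      rw [LoopGraph.numLoops, ← Set.ncard_coe_finset]
      simp [B]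
    rw [h2, ← nsmul_eq_mul]
    exact Finset.sum_le_card_nsmul _ _ _ fun i _ => (hev i D hD).le

/-- Integrals of a bounded function against the laws of two coupled variables. -/
theorem abs_integral_map_sub_le {α X : Type*} [MeasurableSpace α] (P : Measure α)
    [IsProbabilityMeasure P] [MeasurableSpace X] [DiscreteMeasurableSpace X] [Countable X]
    {f g : α → X} (hf : Measurable f) (hg : Measurable g) (F : X → ℝ) {M : ℝ}
    (hF : ∀ x, |F x| ≤ M) :
    |∫ x, F x ∂(P.map f) - ∫ x, F x ∂(P.map g)| ≤ 2 * M * P.real {a | f a ≠ g a} := by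
  have hFm : Measurable F := measurable_of_countable F
  have hint : ∀ {h : α → X}, Measurable h → Integrable (fun a => F (h a)) P := fun hh =>
    Integrable.of_bound (hFm.comp hh).aestronglyMeasurable M (Eventually.of_forall fun a => hF _)
  have hS : MeasurableSet {a | f a ≠ g a} := (measurableSet_eq_fun hf hg).compl
  rw [integral_map hf.aemeasurable hFm.aestronglyMeasurable,
    integral_map hg.aemeasurable hFm.aestronglyMeasurable, ← integral_sub (hint hf) (hint hg),
    ← Real.norm_eq_abs]
  refine (norm_integral_le_of_norm_le
    (g := Set.indicator {a | f a ≠ g a} fun _ => 2 * M) ?_ ?_).trans ?_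
  · exact (integrable_const _).indicator hS
  · refine Eventually.of_forall fun a => ?_
    by_cases h : f a = g a
    · rw [Set.indicator_of_notMem (by simpa using h), h]
      simp
    · rw [Set.indicator_of_mem (by simpa using h)]
      refine (norm_sub_le _ _).trans ?_
      rw [Real.norm_eq_abs, Real.norm_eq_abs]
      linarith [hF (f a), hF (g a)]
  · rw [integral_indicator_const _ hS, smul_eq_mul, mul_comm]

/-- The Poisson and Bernoulli blow-ups of a graph with rates `q ≤ p ≤ 1` are close when
`2 e(G) p` and the number of loops are small compared with `1 / (p - q + q ^ 2)`. -/
theorem abs_integral_blowupLaw_sub_le {n : ℕ} (G : LoopGraph (Fin n)) {p q : ℝ≥0} (hqp : q ≤ p)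
    (hp : p ≤ 1) (F : UnlabeledGraph → ℝ) {M : ℝ} (hF : ∀ x, |F x| ≤ M) :
    |∫ x, F x ∂(blowupLaw G (poissonMeasure q)) - ∫ x, F x ∂(blowupLaw G (bernoulliNat p))| ≤
      2 * M * ((2 * G.numEdges * p + G.numLoops) * (p - q + q ^ 2)) := by
  obtain ⟨κ, hκ, h1, h2, h3, h4⟩ := exists_poisson_bernoulli_coupling hqp hp
  have hM : 0 ≤ M := (abs_nonneg _).trans (hF (UnlabeledGraph.mk LoopGraph.empty))
  have h5 : κ.real {x | x.2 ≠ 0} = p := by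
    have : κ.real {x | x.2 ≠ 0} = (κ.map Prod.snd).real {0}ᶜ := by
      rw [map_measureReal_apply measurable_snd (measurableSet_singleton 0).compl]
      rfl
    rw [this, h2, Measure.real, bernoulliNat_apply]
    simp
  rw [← h1, ← h2, blowupLaw_map G κ measurable_fst, blowupLaw_map G κ measurable_snd]
  refine (abs_integral_map_sub_le _ (measurable_of_countable _) (measurable_of_countable _)
    F hF).trans (mul_le_mul_of_nonneg_left ?_ (by positivity))
  refine (measureReal_blowup_ne_le G κ h3).trans ?_
  rw [h5]
  calc _ = (2 * G.numEdges * p + G.numLoops) * κ.real {x | x.1 ≠ x.2} := by ring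
    _ ≤ _ := mul_le_mul_of_nonneg_left h4 (by positivity)

/-! ### Counts of Poisson points -/

theorem integral_infinitePi_finset_prod {ι : Type*} {X : ι → Type*} [∀ i, MeasurableSpace (X i)]
    (μ : ∀ i, Measure (X i)) [∀ i, IsProbabilityMeasure (μ i)] (s : Finset ι)
    (f : ∀ i, X i → ℂ) (hf : ∀ i, Measurable (f i)) :
    ∫ x, ∏ i ∈ s, f i (x i) ∂(Measure.infinitePi μ) = ∏ i ∈ s, ∫ x, f i x ∂(μ i) := by
  have h1 : ∀ x : ∀ i, X i, ∏ i ∈ s, f i (x i) =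
      (fun y : ∀ i : s, X i => ∏ i : s, f i (y i)) (s.restrict x) := fun x =>
    (Finset.prod_coe_sort s fun i => f i (x i)).symm
  have hm : Measurable fun y : ∀ i : s, X i => ∏ i : s, f i (y i) :=
    Finset.measurable_fun_prod _ fun i _ => (hf i).comp (measurable_pi_apply i)
  rw [integral_congr_ae (Eventually.of_forall h1)]
  refine (integral_restrict_infinitePi μ (s := s) hm.aestronglyMeasurable).trans ?_
  rw [integral_fintype_prod_eq_prod (μ := fun i : s => μ i) (fun (i : s) => f i),
    Finset.prod_coe_sort s fun i => ∫ x, f i x ∂(μ i)]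

theorem integral_pow_poissonMeasure (q : ℝ≥0) (z : ℂ) :
    ∫ k, z ^ k ∂(poissonMeasure q) = Complex.exp (q * (z - 1)) := by
  rw [integral_poissonMeasure]
  have : ∀ k : ℕ, (Real.exp (-q) * (q : ℝ) ^ k / (k.factorial : ℝ)) • z ^ k =
      Complex.exp (-q) * ((q * z) ^ k / k.factorial) := by
    intro k
    rw [Complex.real_smul, mul_pow]
    push_cast
    ring
  simp_rw [this]
  rw [tsum_mul_left, (NormedSpace.expSeries_div_hasSum_exp (q * z : ℂ)).tsum_eq,
    ← Complex.exp_eq_exp_ℂ, ← Complex.exp_add]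
  ring_nf

/-- A probability measure on `ℕ^n` is the product of Poisson laws as soon as its characteristic
function is. -/
theorem eq_pi_poissonMeasure {n : ℕ} (μ : Measure (Fin n → ℕ)) [IsProbabilityMeasure μ]
    (lam : Fin n → ℝ≥0)
    (h : ∀ t : Fin n → ℝ, ∫ N, ∏ v, Complex.exp (t v * Complex.I) ^ N v ∂μ =
      ∏ v, Complex.exp (lam v * (Complex.exp (t v * Complex.I) - 1))) :
    μ = Measure.pi fun v => poissonMeasure (lam v) := by
  let cst : (Fin n → ℕ) → Fin n → ℝ := fun N v => N v
  have hcst : Measurable cst := measurable_of_countable _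
  have hreal : μ.map cst = Measure.pi fun v => (poissonMeasure (lam v)).map (Nat.cast : ℕ → ℝ) := by
    have : IsProbabilityMeasure (μ.map cst) := Measure.isProbabilityMeasure_map hcst.aemeasurable
    refine charFun_eq_pi_iff.1 fun t => ?_
    rw [charFun_apply, integral_map (by fun_prop) (by fun_prop),
      integral_map hcst.aemeasurable (by fun_prop)]
    simp_rw [charFun_map_cast_poissonMeasure]
    rw [← h]
    refine integral_congr_ae (Eventually.of_forall fun N => ?_)
    simp only [PiLp.inner_apply, cst]
    push_cast
    rw [Finset.sum_mul, Complex.exp_sum]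
    refine Finset.prod_congr rfl fun v _ => ?_
    rw [← Complex.exp_nat_mul]
    congr 1
    simp
    ring
  have hfl : Measurable fun x : Fin n → ℝ => fun v => ⌊x v⌋₊ := by fun_prop
  have hid : (fun x : Fin n → ℝ => fun v => ⌊x v⌋₊) ∘ cst = id := by
    funext N v
    simp [cst]
  rw [← Measure.pi_map_pi (fun v => (measurable_of_countable _).aemeasurable)] at hreal
  have h2 := congrArg (Measure.map fun x : Fin n → ℝ => fun v => ⌊x v⌋₊) hreal
  rw [Measure.map_map hfl hcst, Measure.map_map hfl (measurable_of_countable _), hid,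
    Measure.map_id] at h2
  rw [h2]
  refine Eq.trans ?_ Measure.map_id
  rw [← hid]

/-- The point of the cube with lower corner `c` and relative position `u`. -/
def cellPos {d : ℕ} (c : Fin d → ℕ) (u : Fin d → unitInterval) : Fin d → ℝ≥0 :=
  fun k => (c k : ℝ≥0) + unitInterval.toNNReal (u k)

theorem measurable_cellPos {d : ℕ} (c : Fin d → ℕ) : Measurable (cellPos c) :=
  measurable_pi_lambda _ fun k =>
    measurable_const.add (measurable_toNNReal.comp (measurable_pi_apply k))

open Classical in
/-- The number of points in `B` of a Poisson process which lie in the cubes with lower corner in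
`F`. -/
def count {d : ℕ} (F : Finset (Fin d → ℕ)) (B : Set (Fin d → ℝ≥0)) (ω : PoissonSpace d) : ℕ :=
  ∑ c ∈ F, ∑ m ∈ Finset.range (ω.1 c), if cellPos c (ω.2 (c, m)) ∈ B then 1 else 0

theorem measurable_count {d : ℕ} (F : Finset (Fin d → ℕ)) {B : Set (Fin d → ℝ≥0)}
    (hB : MeasurableSet B) : Measurable (count F B) := by
  classical
  refine Finset.measurable_fun_sum _ fun c _ => ?_
  have h : ∀ M : ℕ, Measurable fun ω : PoissonSpace d =>
      ∑ m ∈ Finset.range M, if cellPos c (ω.2 (c, m)) ∈ B then 1 else 0 := by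
    intro M
    refine Finset.measurable_fun_sum _ fun m _ =>
      Measurable.ite ?_ measurable_const measurable_const
    exact ((measurable_cellPos c).comp ((measurable_pi_apply (c, m)).comp measurable_snd)) hB
  have h2 : Measurable fun p : ℕ × PoissonSpace d =>
      ∑ m ∈ Finset.range p.1, if cellPos c (p.2.2 (c, m)) ∈ B then 1 else 0 :=
    measurable_from_prod_countable_right h
  have h3 : Measurable fun ω : PoissonSpace d => (ω.1 c, ω) :=
    ((measurable_pi_apply c).comp measurable_fst).prodMk measurable_id
  exact h2.comp h3

/-- The numbers of points of a Poisson process in disjoint sets are independent Poisson variables,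
whose means are the volumes of the sets. -/
theorem map_count_poissonLaw {d n : ℕ} (F : Finset (Fin d → ℕ)) (B : Fin n → Set (Fin d → ℝ≥0))
    (hB : ∀ v, MeasurableSet (B v)) (hdisj : ∀ v w x, x ∈ B v → x ∈ B w → v = w)
    (lam : Fin n → ℝ≥0)
    (hlam : ∀ v, (lam v : ℝ) =
      ∑ c ∈ F, (Measure.pi fun _ : Fin d => (volume : Measure unitInterval)).real
        (cellPos c ⁻¹' B v)) :
    (poissonLaw d).map (fun ω v => count F (B v) ω) =
      Measure.pi fun v => poissonMeasure (lam v) := by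
  classical
  have hcount : Measurable fun ω : PoissonSpace d => fun v => count F (B v) ω :=
    measurable_pi_lambda _ fun v => measurable_count F (hB v)
  have : IsProbabilityMeasure ((poissonLaw d).map fun ω v => count F (B v) ω) :=
    Measure.isProbabilityMeasure_map hcount.aemeasurable
  refine eq_pi_poissonMeasure _ lam fun t => ?_
  set vol : Measure (Fin d → unitInterval) := Measure.pi fun _ => volume with hvol
  set z : Fin n → ℂ := fun v => Complex.exp (t v * Complex.I) with hz
  -- A point at relative position `u` in the cube `c` contributes the factor `φ c u`.
  set φ : (Fin d → ℕ) → (Fin d → unitInterval) → ℂ :=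
    fun c u => ∏ v, if cellPos c u ∈ B v then z v else 1 with hφ
  have hφm : ∀ c, Measurable (φ c) := fun c => Finset.measurable_prod _ fun v _ =>
    Measurable.ite (measurable_cellPos c (hB v)) measurable_const measurable_const
  have hφint : ∀ c, ∫ u, φ c u ∂vol - 1 = ∑ v, (vol.real (cellPos c ⁻¹' B v) : ℂ) * (z v - 1) := by
    intro c
    have h1 : ∀ u, φ c u = 1 + ∑ v, (cellPos c ⁻¹' B v).indicator (fun _ => z v - 1) u := by
      intro u
      by_cases hu : ∃ w, cellPos c u ∈ B w
      · obtain ⟨w, hw⟩ := hu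
        have hne : ∀ v, v ≠ w → cellPos c u ∉ B v := fun v hv h => hv (hdisj _ _ _ h hw)
        rw [hφ]
        simp only
        rw [Finset.prod_eq_single w (fun v _ hv => if_neg (hne v hv)) (by simp), if_pos hw,
          Finset.sum_eq_single w (fun v _ hv => Set.indicator_of_notMem
            (s := cellPos c ⁻¹' B v) (hne v hv) _) (by simp),
          Set.indicator_of_mem (s := cellPos c ⁻¹' B w) hw]
        ring
      · push Not at hu
        rw [hφ]
        simp only
        rw [Finset.prod_eq_one fun v _ => if_neg (hu v),
          Finset.sum_eq_zero fun v _ =>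
            Set.indicator_of_notMem (s := cellPos c ⁻¹' B v) (hu v) _, add_zero]
    have hi : ∀ v, Integrable ((cellPos c ⁻¹' B v).indicator fun _ => z v - 1) vol := fun v =>
      (integrable_const _).indicator (measurable_cellPos c (hB v))
    simp_rw [h1]
    rw [integral_add (integrable_const _) (integrable_finsetSum _ fun v _ => hi v),
      integral_finsetSum _ fun v _ => hi v]
    simp_rw [integral_indicator_const _ (measurable_cellPos c (hB _))]
    simp
  have hprod : ∀ ω : PoissonSpace d, ∏ v, z v ^ count F (B v) ω =
      ∏ c ∈ F, ∏ m ∈ Finset.range (ω.1 c), φ c (ω.2 (c, m)) := by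
    intro ω
    simp_rw [count, hφ]
    simp_rw [Finset.prod_comm (s := Finset.range _) (t := Finset.univ)]
    rw [Finset.prod_comm]
    refine Finset.prod_congr rfl fun v _ => ?_
    rw [← Finset.prod_pow_eq_pow_sum]
    refine Finset.prod_congr rfl fun c _ => ?_
    rw [← Finset.prod_pow_eq_pow_sum]
    refine Finset.prod_congr rfl fun m _ => ?_
    split_ifs <;> simp
  have hmeas : Measurable fun ω : PoissonSpace d => ∏ v, z v ^ count F (B v) ω :=
    Finset.measurable_prod _ fun v _ =>
      (measurable_of_countable (fun k : ℕ => z v ^ k)).comp (measurable_count F (hB v))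
  rw [integral_map hcount.aemeasurable (measurable_of_countable _).aestronglyMeasurable,
    poissonLaw, integral_prod]
  swap
  · refine Integrable.of_bound hmeas.aestronglyMeasurable 1 (Eventually.of_forall fun ω => ?_)
    rw [norm_prod]
    simp
  have hinner : ∀ N : (Fin d → ℕ) → ℕ,
      ∫ U : PointIndex d → Fin d → unitInterval, ∏ v, z v ^ count F (B v) (N, U)
        ∂(Measure.infinitePi fun _ => vol) = ∏ c ∈ F, (∫ u, φ c u ∂vol) ^ N c := by
    intro N
    simp_rw [hprod]
    have h2 : ∀ U : PointIndex d → Fin d → unitInterval,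
        ∏ c ∈ F, ∏ m ∈ Finset.range (N c), φ c (U (c, m)) =
          ∏ i ∈ (F.sigma fun c => Finset.range (N c)).map (Equiv.sigmaEquivProd _ _).toEmbedding,
            φ i.1 (U i) := by
      intro U
      rw [Finset.prod_map, Finset.prod_sigma]
      rfl
    simp_rw [h2]
    rw [integral_infinitePi_finset_prod (fun _ : PointIndex d => vol) _
      (fun i => φ i.1) (fun i => hφm i.1), Finset.prod_map, Finset.prod_sigma]
    refine Finset.prod_congr rfl fun c _ => ?_
    simp
  refine (integral_congr_ae (Eventually.of_forall hinner)).trans ?_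
  rw [integral_infinitePi_finset_prod (fun _ : Fin d → ℕ => poissonMeasure 1) F
    (fun c k => (∫ u, φ c u ∂vol) ^ k) (fun _ => measurable_of_countable _)]
  simp_rw [integral_pow_poissonMeasure, hφint]
  rw [← Complex.exp_sum, ← Complex.exp_sum]
  congr 1
  simp only [NNReal.coe_one, Complex.ofReal_one, one_mul]
  rw [Finset.sum_comm]
  refine Finset.sum_congr rfl fun v _ => ?_
  have := congrArg (Complex.ofReal) (hlam v)
  rw [show ((lam v : ℝ) : ℂ) = _ from this, Complex.ofReal_sum, Finset.sum_mul]

/-! ### Volumes of boxes, cube by cube -/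

theorem volume_real_toNNReal_lt (c : ℕ) (x : ℝ≥0) :
    (volume : Measure unitInterval).real {u | (c : ℝ≥0) + unitInterval.toNNReal u < x} =
      (min (x - c) 1 : ℝ≥0) := by
  rcases le_total x c with h | h
  · have : {u : unitInterval | (c : ℝ≥0) + unitInterval.toNNReal u < x} = ∅ := by
      ext u
      simpa using h.trans le_self_add
    rw [this, tsub_eq_zero_of_le h]
    simp
  rcases le_or_gt (x - c) 1 with h1 | h1
  · have : {u : unitInterval | (c : ℝ≥0) + unitInterval.toNNReal u < x} =
        Set.Iio ⟨((x - c : ℝ≥0) : ℝ), (x - c).2, h1⟩ := by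
      ext u
      show _ ↔ (u : ℝ) < ((x - c : ℝ≥0) : ℝ)
      rw [← unitInterval.coe_toNNReal, NNReal.coe_lt_coe, lt_tsub_iff_left]
      rfl
    rw [this, Measure.real, unitInterval.volume_Iio, min_eq_left h1]
    exact ENNReal.toReal_ofReal (x - c).2
  · have : {u : unitInterval | (c : ℝ≥0) + unitInterval.toNNReal u < x} = Set.univ := by
      ext u
      simp only [Set.mem_ofPred_eq, Set.mem_univ, iff_true]
      rw [← lt_tsub_iff_left]
      refine lt_of_le_of_lt ?_ h1
      exact u.2.2
    rw [this, min_eq_right h1.le]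
    simp

theorem sum_min_tsub_one (K : ℕ) (x : ℝ≥0) :
    ∑ c ∈ Finset.range K, min (x - c) 1 = min x K := by
  induction K with
  | zero => simp
  | succ K ih =>
    rw [Finset.sum_range_succ, ih]
    rcases le_total x K with h | h
    · rw [min_eq_left h, tsub_eq_zero_of_le h, min_eq_left (h.trans (by simp))]
      simp
    · rw [min_eq_right h, ← min_add_add_left, add_tsub_cancel_of_le h]
      push_cast
      rfl

theorem measurableSet_toNNReal_add (c : ℕ) {S : Set ℝ≥0} (hS : MeasurableSet S) :
    MeasurableSet {u : unitInterval | (c : ℝ≥0) + unitInterval.toNNReal u ∈ S} :=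
  (measurable_const.add measurable_toNNReal) hS

theorem sum_volume_real_Ico (K : ℕ) {a b : ℝ≥0} (hab : a ≤ b) (hb : b ≤ K) :
    ∑ c ∈ Finset.range K, (volume : Measure unitInterval).real
      {u | (c : ℝ≥0) + unitInterval.toNNReal u ∈ Set.Ico a b} = b - a := by
  have h : ∀ c : ℕ, (volume : Measure unitInterval).real
      {u | (c : ℝ≥0) + unitInterval.toNNReal u ∈ Set.Ico a b} =
        (min (b - c) 1 : ℝ≥0) - (min (a - c) 1 : ℝ≥0) := by
    intro c
    have : {u : unitInterval | (c : ℝ≥0) + unitInterval.toNNReal u ∈ Set.Ico a b} =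
        {u | (c : ℝ≥0) + unitInterval.toNNReal u < b} \
          {u | (c : ℝ≥0) + unitInterval.toNNReal u < a} := by
      ext u
      simp [and_comm]
    have hsub : {u : unitInterval | (c : ℝ≥0) + unitInterval.toNNReal u < a} ⊆
        {u | (c : ℝ≥0) + unitInterval.toNNReal u < b} := fun u hu => lt_of_lt_of_le hu hab
    rw [this, measureReal_sdiff hsub (measurableSet_toNNReal_add c measurableSet_Iio),
      volume_real_toNNReal_lt, volume_real_toNNReal_lt]
  simp_rw [h]
  rw [Finset.sum_sub_distrib, ← NNReal.coe_sum, ← NNReal.coe_sum, sum_min_tsub_one,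
    sum_min_tsub_one, min_eq_left hb, min_eq_left (hab.trans hb)]

theorem sum_volume_real_Iic (K : ℕ) {r : ℝ≥0} (hr : r ≤ K) :
    ∑ c ∈ Finset.range K, (volume : Measure unitInterval).real
      {u | (c : ℝ≥0) + unitInterval.toNNReal u ∈ Set.Iic r} = r := by
  have h : ∀ c : ℕ, (volume : Measure unitInterval).real
      {u | (c : ℝ≥0) + unitInterval.toNNReal u ∈ Set.Iic r} = (min (r - c) 1 : ℝ≥0) := by
    intro c
    rw [← volume_real_toNNReal_lt]
    have hsub : ({u | (c : ℝ≥0) + unitInterval.toNNReal u = r} : Set unitInterval).Subsingleton := by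
      intro u hu v hv
      have h1 : unitInterval.toNNReal u = unitInterval.toNNReal v :=
        add_left_cancel (Eq.trans hu (Eq.symm hv))
      exact Subtype.ext (congrArg NNReal.toReal h1)
    refine measureReal_congr ?_
    filter_upwards [measure_eq_zero_iff_ae_notMem.1 (hsub.measure_zero volume)] with u hu
    exact propext ⟨fun h => lt_of_le_of_ne h hu, fun h => le_of_lt h⟩
  simp_rw [h]
  rw [← NNReal.coe_sum, sum_min_tsub_one, min_eq_left hr]

theorem sum_volume_real_pi {d : ℕ} (K : ℕ) (S : Fin d → Set ℝ≥0) :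
    ∑ c ∈ Fintype.piFinset fun _ : Fin d => Finset.range K,
      (Measure.pi fun _ : Fin d => (volume : Measure unitInterval)).real
        (cellPos c ⁻¹' {x | ∀ k, x k ∈ S k}) =
      ∏ k, ∑ c ∈ Finset.range K, (volume : Measure unitInterval).real
        {u | (c : ℝ≥0) + unitInterval.toNNReal u ∈ S k} := by
  rw [Finset.prod_univ_sum]
  refine Finset.sum_congr rfl fun c _ => ?_
  have : cellPos c ⁻¹' {x | ∀ k, x k ∈ S k} =
      Set.univ.pi fun k => {u : unitInterval | (c k : ℝ≥0) + unitInterval.toNNReal u ∈ S k} := by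
    ext u
    simp [cellPos]
  rw [this, Measure.real, Measure.pi_pi, ENNReal.toReal_prod]
  rfl

/-! ### The stretched graphon -/

theorem leb_Ico {a b : ℝ≥0} (hab : a ≤ b) : leb (Set.Ico a b) = ((b - a : ℝ≥0) : ℝ≥0∞) := by
  have : Set.Ico a b = Set.Iio b \ Set.Iio a := by
    ext x
    simp
  rw [this, measure_sdiff (Set.Iio_subset_Iio hab) measurableSet_Iio.nullMeasurableSet, leb_Iio,
    leb_Iio, ENNReal.coe_sub]
  rw [leb_Iio]
  exact ENNReal.coe_ne_top

/-- The number of ordered adjacent pairs, `2 e(G)` plus the number of loops. -/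
def adjCount {n : ℕ} (G : LoopGraph (Fin n)) : ℝ≥0 := 2 * G.numEdges + G.numLoops

theorem Ico_div_inj {b : ℝ≥0} {n : ℕ} {i j : Fin n} {x : ℝ≥0}
    (hi : x ∈ Set.Ico ((i : ℕ) / b) (((i : ℕ) + 1) / b))
    (hj : x ∈ Set.Ico ((j : ℕ) / b) (((j : ℕ) + 1) / b)) : i = j := by
  have hb : 0 < b := by
    rcases eq_or_ne b 0 with rfl | hb
    · simpa using hi.2
    · exact pos_iff_ne_zero.2 hb
  have h1 := hi.1.trans_lt hj.2
  have h2 := hj.1.trans_lt hi.2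
  rw [div_lt_div_iff_of_pos_right hb] at h1 h2
  norm_cast at h1 h2
  ext
  omega

theorem l1Norm_empGraphon {n : ℕ} (G : LoopGraph (Fin n)) :
    l1Norm (empGraphon G) = ((adjCount G / (n : ℝ≥0) ^ 2 : ℝ≥0) : ℝ≥0∞) := by
  classical
  let S : Fin n → Set ℝ≥0 := fun i => Set.Ico ((i : ℕ) / (n : ℝ≥0)) (((i : ℕ) + 1) / (n : ℝ≥0))
  let A : Finset (Fin n × Fin n) := Finset.univ.filter fun p => G.Adj p.1 p.2
  have hS : ∀ i, MeasurableSet (S i) := fun _ => measurableSet_Ico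
  have hSinj : ∀ i j x, x ∈ S i → x ∈ S j → i = j := fun i j x hi hj =>
    Ico_div_inj (b := (n : ℝ≥0)) (i := i) (j := j) hi hj
  have hleb : ∀ i, leb (S i) = (((n : ℝ≥0)⁻¹ : ℝ≥0) : ℝ≥0∞) := by
    intro i
    have h : ((i : ℕ) : ℝ≥0) / (n : ℝ≥0) ≤ ((i : ℕ) + 1) / (n : ℝ≥0) := by
      gcongr
      exact le_self_add
    rw [leb_Ico h, ← tsub_div]
    simp
  have hW : ∀ x y, (empGraphon G x y : ℝ≥0∞) =
      ∑ p ∈ A, (S p.1).indicator 1 x * (S p.2).indicator 1 y := by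
    intro x y
    unfold empGraphon
    split_ifs with h
    · obtain ⟨i, j, hij, hx, hy⟩ := h
      have hx' : x ∈ S i := hx
      have hy' : y ∈ S j := hy
      rw [Finset.sum_eq_single (i, j)]
      · simp [Set.indicator_of_mem hx', Set.indicator_of_mem hy']
      · rintro ⟨i', j'⟩ - hne
        by_cases h1 : x ∈ S i'
        · by_cases h2 : y ∈ S j'
          · have e1 : i' = i := hSinj i' i x h1 hx'
            have e2 : j' = j := hSinj j' j y h2 hy'
            exact absurd (by rw [e1, e2]) hne
          · simp [Set.indicator_of_notMem h2]
        · simp [Set.indicator_of_notMem h1]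
      · intro h'
        exact absurd (by simpa [A] using hij) h'
    · refine (Finset.sum_eq_zero fun p hp => ?_).symm
      by_cases h1 : x ∈ S p.1
      · by_cases h2 : y ∈ S p.2
        · exact absurd ⟨p.1, p.2, by simpa [A] using hp, h1, h2⟩ h
        · simp [Set.indicator_of_notMem h2]
      · simp [Set.indicator_of_notMem h1]
  have hcard : ((A.card : ℕ) : ℝ≥0) = adjCount G := by
    have h3 : A.card = 2 * G.numEdges + G.numLoops := by
      rw [← G.card_filter_adj]
    rw [h3, adjCount]
    push_cast
    rfl
  have h1 : ∀ i, Measurable ((S i).indicator (1 : ℝ≥0 → ℝ≥0∞)) := fun i =>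
    measurable_one.indicator (hS i)
  unfold l1Norm
  simp_rw [hW]
  have h2 : ∀ x, ∫⁻ y, ∑ p ∈ A, (S p.1).indicator (1 : ℝ≥0 → ℝ≥0∞) x * (S p.2).indicator 1 y ∂leb =
      ∑ p ∈ A, (S p.1).indicator 1 x * (((n : ℝ≥0)⁻¹ : ℝ≥0) : ℝ≥0∞) := by
    intro x
    rw [lintegral_finsetSum _ fun p _ => (h1 p.2).const_mul _]
    refine Finset.sum_congr rfl fun p _ => ?_
    rw [lintegral_const_mul _ (h1 p.2), lintegral_indicator_one (hS p.2), hleb]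
  simp_rw [h2]
  rw [lintegral_finsetSum _ fun p _ => (h1 p.1).mul_const _]
  simp_rw [lintegral_mul_const _ (h1 _), lintegral_indicator_one (hS _), hleb]
  rw [Finset.sum_const, nsmul_eq_mul, ← hcard]
  push_cast [← ENNReal.coe_mul, ← ENNReal.coe_natCast]
  congr 1
  rw [div_eq_mul_inv, sq, mul_inv]

theorem stretch_eq {n : ℕ} (G : LoopGraph (Fin n)) :
    stretch G = NNReal.sqrt (adjCount G) / n := by
  rw [stretch, l1Norm_empGraphon, ENNReal.toNNReal_coe, NNReal.sqrt_div, NNReal.sqrt_sq]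

open Classical in
/-- In the stretched graphon every vertex occupies an interval of length `1 / √(adjCount G)`. -/
theorem strGraphon_eq {n : ℕ} (G : LoopGraph (Fin n)) (hG : 0 < adjCount G) (x y : ℝ≥0) :
    strGraphon G x y = if ∃ i j : Fin n, G.Adj i j ∧
      x ∈ Set.Ico ((i : ℕ) / NNReal.sqrt (adjCount G)) (((i : ℕ) + 1) / NNReal.sqrt (adjCount G)) ∧
      y ∈ Set.Ico ((j : ℕ) / NNReal.sqrt (adjCount G)) (((j : ℕ) + 1) / NNReal.sqrt (adjCount G))
      then 1 else 0 := by
  have hb : 0 < NNReal.sqrt (adjCount G) := NNReal.sqrt_pos.2 hG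
  set b := NNReal.sqrt (adjCount G)
  have hscale : ∀ (i : Fin n) (x : ℝ≥0), (b / n * x ∈ Set.Ico ((i : ℕ) / (n : ℝ≥0))
      (((i : ℕ) + 1) / (n : ℝ≥0))) ↔ x ∈ Set.Ico ((i : ℕ) / b) (((i : ℕ) + 1) / b) := by
    intro i x
    have hn : (0 : ℝ≥0) < n := Nat.cast_pos.2 i.pos
    rw [Set.mem_Ico, Set.mem_Ico, div_mul_eq_mul_div, div_le_div_iff_of_pos_right hn,
      div_lt_div_iff_of_pos_right hn, div_le_iff₀ hb, lt_div_iff₀ hb, mul_comm b x]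
  have hlt : ∀ (i : Fin n) (x : ℝ≥0), x ∈ Set.Ico ((i : ℕ) / b) (((i : ℕ) + 1) / b) →
      x < (b / n)⁻¹ := by
    intro i x hx
    refine hx.2.trans_le ?_
    rw [inv_div]
    gcongr
    exact_mod_cast i.2
  unfold strGraphon empGraphon
  rw [show stretch G = b / n from stretch_eq G]
  simp_rw [hscale]
  by_cases h : ∃ i j : Fin n, G.Adj i j ∧ x ∈ Set.Ico ((i : ℕ) / b) (((i : ℕ) + 1) / b) ∧
      y ∈ Set.Ico ((j : ℕ) / b) (((j : ℕ) + 1) / b)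
  · rw [if_pos h, if_pos]
    obtain ⟨i, j, -, hx, hy⟩ := h
    exact ⟨hlt i x hx, hlt j y hy⟩
  · rw [if_neg h, ite_self]

/-! ### Almost sure properties of the driving processes -/

theorem measurePreserving_poissonSpace_snd {d : ℕ} (i : PointIndex d) (k : Fin d) :
    MeasurePreserving (fun ω : PoissonSpace d => ω.2 i k) (poissonLaw d) volume :=
  ((measurePreserving_eval (fun _ : Fin d => (volume : Measure unitInterval)) k).comp
    (measurePreserving_eval_infinitePi (fun _ : PointIndex d =>
      Measure.pi fun _ : Fin d => (volume : Measure unitInterval)) i)).comp measurePreserving_snd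

theorem ae_coord_ne_zero {d : ℕ} (i : PointIndex d) (k : Fin d) :
    ∀ᵐ ω ∂(poissonLaw d), coord ω i k ≠ 0 := by
  have h : ∀ᵐ u : unitInterval, u ≠ 0 := by simp [ae_iff]
  filter_upwards [(measurePreserving_poissonSpace_snd i k).quasiMeasurePreserving.ae h] with ω hω h0
  apply hω
  have := (add_eq_zero.1 h0).2
  exact Subtype.ext (congrArg NNReal.toReal this)

theorem ae_coord_ne_coord {d : ℕ} {i j : PointIndex d} (hij : i ≠ j) (k : Fin d) :
    ∀ᵐ ω ∂(poissonLaw d), coord ω i k ≠ coord ω j k := by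
  set μ : Measure (PointIndex d → Fin d → unitInterval) :=
    Measure.infinitePi fun _ => Measure.pi fun _ => volume with hμ
  let e : PointIndex d → (PointIndex d → Fin d → unitInterval) → unitInterval := fun i U => U i k
  have he : ∀ i, MeasurePreserving (e i) μ volume := fun i =>
    (measurePreserving_eval (fun _ : Fin d => (volume : Measure unitInterval)) k).comp
      (measurePreserving_eval_infinitePi (fun _ : PointIndex d =>
        Measure.pi fun _ : Fin d => (volume : Measure unitInterval)) i)
  have hind : iIndepFun e μ := iIndepFun_infinitePi (X := fun _ (u : Fin d → unitInterval) => u k)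
    fun _ => measurable_pi_apply k
  have hmap : μ.map (fun U => (e i U, e j U)) = (volume : Measure unitInterval).prod volume := by
    rw [(indepFun_iff_map_prod_eq_prod_map_map (he i).measurable.aemeasurable
      (he j).measurable.aemeasurable).1 (hind.indepFun hij), (he i).map_eq, (he j).map_eq]
  let pos : ℕ → unitInterval → ℝ≥0 := fun c u => c + unitInterval.toNNReal u
  have hpos : ∀ c, Measurable (pos c) := fun c => measurable_const.add measurable_toNNReal
  have hne : ∀ᵐ p ∂((volume : Measure unitInterval).prod (volume : Measure unitInterval)),
      pos (i.1 k) p.1 ≠ pos (j.1 k) p.2 := by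
    have hm : MeasurableSet {p : unitInterval × unitInterval |
        pos (i.1 k) p.1 = pos (j.1 k) p.2} :=
      measurableSet_eq_fun ((hpos _).comp measurable_fst) ((hpos _).comp measurable_snd)
    rw [ae_iff]
    simp only [ne_eq, not_not]
    rw [Measure.measure_prod_null hm]
    refine Eventually.of_forall fun u => Set.Subsingleton.measure_zero ?_ _
    intro v hv w hw
    have h1 : unitInterval.toNNReal v = unitInterval.toNNReal w :=
      add_left_cancel (Eq.trans (Eq.symm hv) hw)
    exact Subtype.ext (congrArg NNReal.toReal h1)
  rw [← hmap] at hne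
  have h2 := ae_of_ae_map ((he i).measurable.prodMk (he j).measurable).aemeasurable hne
  have hsnd : MeasurePreserving (Prod.snd : PoissonSpace d → _) (poissonLaw d) μ :=
    measurePreserving_snd
  filter_upwards [hsnd.quasiMeasurePreserving.ae h2] with ω hω
  exact hω

open DrivingSpace

theorem ae_drivingLaw :
    ∀ᵐ ω ∂drivingLaw, (∀ i j, i ≠ j → θ ω i ≠ θ ω j) ∧ (∀ e, ζ ω e ≠ 0) ∧
      (∀ j k, χ ω j k ≠ 0) ∧ ∀ k, η ω k ≠ 0 := by
  have h1 : MeasurePreserving (fun ω : DrivingSpace => ω.1) drivingLaw (poissonLaw 2) :=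
    measurePreserving_fst
  have h2' : MeasurePreserving (fun ω : DrivingSpace => ω.2) drivingLaw _ := measurePreserving_snd
  have h2 := measurePreserving_fst.comp h2'
  have h3' := measurePreserving_snd.comp h2'
  have h3 := measurePreserving_fst.comp h3'
  have h4 := measurePreserving_snd.comp h3'
  have hu : ∀ᵐ u : unitInterval, u ≠ 0 := by simp [ae_iff]
  refine Filter.Eventually.and ?_ (Filter.Eventually.and ?_ (Filter.Eventually.and ?_ ?_))
  · refine ae_all_iff.2 fun i => ae_all_iff.2 fun j => ?_
    by_cases hij : i = j
    · simp [hij]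
    · filter_upwards [h1.quasiMeasurePreserving.ae (ae_coord_ne_coord hij 0)] with ω hω _
      exact hω
  · have : ∀ e : Sym2 (PointIndex 2), ∀ᵐ ω ∂drivingLaw, ζ ω e ≠ 0 := by
      intro e
      have h5 := (measurePreserving_eval_infinitePi
        (fun _ : Sym2 (PointIndex 2) => (volume : Measure unitInterval)) e).comp h4
      filter_upwards [h5.quasiMeasurePreserving.ae hu] with ω hω h0
      exact hω (Subtype.ext (congrArg NNReal.toReal h0))
    have hc : Countable (Sym2 (PointIndex 2)) := Quotient.countable
    exact ae_all_iff.2 this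
  · refine ae_all_iff.2 fun j => ae_all_iff.2 fun k => ?_
    have h5 := (measurePreserving_eval_infinitePi
      (fun _ : PointIndex 2 => poissonLaw 2) j).comp h2
    exact h5.quasiMeasurePreserving.ae (ae_coord_ne_zero k 1)
  · exact ae_all_iff.2 fun k => h3.quasiMeasurePreserving.ae (ae_coord_ne_zero k 2)

/-! ### The graphex process of a stretched graphon -/

/-- Outside a null set only the graphon part of the graphex process of `(0, 0, W)` contributes. -/
theorem graphexProcess_adj_iff (𝓦 : Graphex) (hI : 𝓦.I = 0) (hS : ∀ x, 𝓦.S x = 0) (s : ℝ≥0)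
    (ω : DrivingSpace) (hχ : ∀ j k, χ ω j k ≠ 0) (hη : ∀ k, η ω k ≠ 0) (x y : ℝ≥0) :
    (graphexProcess 𝓦 s ω).Adj x y ↔
      ∃ i j, graphonEvent 𝓦 ω i j ∧ θ ω i = x ∧ θ ω j = y ∧ x ≤ s ∧ y ≤ s := by
  classical
  have hatom : ∀ a b, adjacencyMeasure 𝓦 ω {(a, b)} ≠ 0 ↔
      ∃ p : PointIndex 2 × PointIndex 2, graphonEvent 𝓦 ω p.1 p.2 ∧
        θ ω p.1 = a ∧ θ ω p.2 = b := by
    intro a b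
    have hstar : ∀ p : PointIndex 2 × PointIndex 2, ¬ starEvent 𝓦 ω p.1 p.2 := by
      rintro p ⟨-, -, h⟩
      rw [hS] at h
      exact hχ _ _ (le_antisymm h bot_le)
    have hiso : ∀ k, ¬ isoEvent 𝓦 ω k := by
      rintro k ⟨-, h⟩
      rw [hI] at h
      exact hη _ (le_antisymm h bot_le)
    unfold adjacencyMeasure
    simp only [hstar, hiso, if_false, Measure.sum_zero, add_zero]
    rw [Ne, Measure.sum_apply_eq_zero]
    push Not
    refine exists_congr fun p => ?_
    by_cases hp : graphonEvent 𝓦 ω p.1 p.2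
    · rw [if_pos hp, Measure.dirac_apply' _ (measurableSet_singleton _)]
      simp [Set.indicator_apply, hp]
    · rw [if_neg hp]
      simp [hp]
  have hsymm : ∀ i j, graphonEvent 𝓦 ω i j → graphonEvent 𝓦 ω j i := by
    rintro i j ⟨h1, h2, h3⟩
    refine ⟨h2, h1, ?_⟩
    rw [Sym2.eq_swap, 𝓦.W_symm]
    exact h3
  have hres : ∀ u v : ℝ≥0,
      ((adjacencyMeasure 𝓦 ω).restrict (Set.Icc 0 s ×ˢ Set.Icc 0 s)) {(u, v)} ≠ 0 ↔
        adjacencyMeasure 𝓦 ω {(u, v)} ≠ 0 ∧ u ≤ s ∧ v ≤ s := by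
    intro u v
    rw [Measure.restrict_apply (measurableSet_singleton _)]
    by_cases h : u ≤ s ∧ v ≤ s
    · rw [Set.inter_eq_left.2 (by simpa using h)]
      simp [h]
    · rw [Set.singleton_inter_eq_empty.2 (by simpa using h)]
      simp [h]
  show (_ ≠ 0 ∨ _ ≠ 0) ↔ _
  rw [hres, hres, hatom, hatom]
  constructor
  · rintro (⟨⟨p, hp, h1, h2⟩, hx, hy⟩ | ⟨⟨p, hp, h1, h2⟩, hy, hx⟩)
    · exact ⟨p.1, p.2, hp, h1, h2, hx, hy⟩
    · exact ⟨p.2, p.1, hsymm _ _ hp, h2, h1, hx, hy⟩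
  · rintro ⟨i, j, hp, h1, h2, hx, hy⟩
    exact Or.inl ⟨⟨(i, j), hp, h1, h2⟩, hx, hy⟩

/-- If the cubes in `F` cover `B`, then `count F B` is the number of all points of the process in `B`,
and there are finitely many of them. -/
theorem finite_and_card_eq_count {d : ℕ} (F : Finset (Fin d → ℕ)) (B : Set (Fin d → ℝ≥0))
    (hF : ∀ c u, cellPos c u ∈ B → c ∈ F) (ω : PoissonSpace d) :
    {i : PointIndex d | IsPoint ω i ∧ (fun k => coord ω i k) ∈ B}.Finite ∧
      {i : PointIndex d | IsPoint ω i ∧ (fun k => coord ω i k) ∈ B}.ncard = count F B ω := by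
  classical
  have h : {i : PointIndex d | IsPoint ω i ∧ (fun k => coord ω i k) ∈ B} =
      ↑(((F.sigma fun c => Finset.range (ω.1 c)).map
        (Equiv.sigmaEquivProd _ _).toEmbedding).filter fun i => cellPos i.1 (ω.2 i) ∈ B) := by
    ext ⟨c, m⟩
    have hpos : (fun k => coord ω (c, m) k) = cellPos c (ω.2 (c, m)) := rfl
    simp only [Set.mem_ofPred_eq, hpos, Finset.coe_filter, Finset.mem_map_equiv]
    constructor
    · rintro ⟨h1, h2⟩
      exact ⟨Finset.mem_sigma.2 ⟨hF _ _ h2, Finset.mem_range.2 h1⟩, h2⟩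
    · rintro ⟨h1, h2⟩
      exact ⟨Finset.mem_range.1 (Finset.mem_sigma.1 h1).2, h2⟩
  rw [h]
  refine ⟨Finset.finite_toSet _, ?_⟩
  rw [Set.ncard_coe_finset, Finset.card_filter, Finset.sum_map, Finset.sum_sigma]
  rfl

/-- The graphex process of a stretched graphon is a blow-up of the graph with independent Poisson
multiplicities: the number of clones of a vertex is the number of Poisson points in the rectangle
`[0, r] × [v / b, (v + 1) / b)`, where `b` is the square root of `adjCount G`. -/
theorem GPD_strGraphex_eq_blowupLaw {n : ℕ} (G : LoopGraph (Fin n)) (hG : 0 < adjCount G)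
    (r : ℝ≥0) :
    (GPD (strGraphex G) r : Measure UnlabeledGraph) =
      blowupLaw G (poissonMeasure (r / NNReal.sqrt (adjCount G))) := by
  classical
  have hb : 0 < NNReal.sqrt (adjCount G) := NNReal.sqrt_pos.2 hG
  have hW := strGraphon_eq G hG
  set b := NNReal.sqrt (adjCount G) with hbdef
  obtain ⟨K, hK⟩ := exists_nat_gt (max r (n / b))
  have hKr : r < K := (le_max_left _ _).trans_lt hK
  have hKn : (n : ℝ≥0) / b < K := (le_max_right _ _).trans_lt hK
  let F : Finset (Fin 2 → ℕ) := Fintype.piFinset fun _ => Finset.range K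
  let I : Fin n → Set ℝ≥0 := fun v => Set.Ico ((v : ℕ) / b) (((v : ℕ) + 1) / b)
  have hIle : ∀ v : Fin n, (((v : ℕ) : ℝ≥0) + 1) / b ≤ n / b := by
    intro v
    gcongr
    exact_mod_cast v.2
  let S : Fin n → Fin 2 → Set ℝ≥0 := fun v => ![Set.Iic r, I v]
  let B : Fin n → Set (Fin 2 → ℝ≥0) := fun v => {x | ∀ k, x k ∈ S v k}
  have hBmem : ∀ v x, x ∈ B v ↔ x 0 ≤ r ∧ x 1 ∈ I v := by
    intro v x
    simp only [B, Set.mem_ofPred_eq, Fin.forall_fin_two]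
    rfl
  have hBm : ∀ v, MeasurableSet (B v) := by
    intro v
    have : B v = {x | x 0 ≤ r} ∩ {x | x 1 ∈ I v} := Set.ext (hBmem v)
    rw [this]
    exact ((measurable_pi_apply 0) measurableSet_Iic).inter
      ((measurable_pi_apply 1) measurableSet_Ico)
  have hdisj : ∀ v w x, x ∈ B v → x ∈ B w → v = w := fun v w x hv hw =>
    Ico_div_inj ((hBmem v x).1 hv).2 ((hBmem w x).1 hw).2
  have hlaw : (poissonLaw 2).map (fun ω v => count F (B v) ω) =
      Measure.pi fun _ : Fin n => poissonMeasure (r / b) := by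
    refine map_count_poissonLaw F B hBm hdisj (fun _ => r / b) fun v => ?_
    have hle : ((v : ℕ) : ℝ≥0) / b ≤ (((v : ℕ) : ℝ≥0) + 1) / b := by
      gcongr
      exact le_self_add
    have h0 := sum_volume_real_Iic K hKr.le
    have h1 := sum_volume_real_Ico K hle ((hIle v).trans hKn.le)
    rw [sum_volume_real_pi K (S v), Fin.prod_univ_two]
    simp only [S, I, Matrix.cons_val_zero, Matrix.cons_val_one]
    rw [h0, h1]
    push_cast
    ring
  have hF : ∀ v c u, cellPos c u ∈ B v → c ∈ F := by
    intro v c u h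
    obtain ⟨h0, h1⟩ := (hBmem _ _).1 h
    refine Fintype.mem_piFinset.2 fun k => Finset.mem_range.2 ?_
    have hk : (c k : ℝ≥0) < K := by
      refine lt_of_le_of_lt (b := cellPos c u k) le_self_add ?_
      revert k
      rw [Fin.forall_fin_two]
      exact ⟨h0.trans_lt hKr, (h1.2.trans_le (hIle v)).trans hKn⟩
    exact_mod_cast hk
  have hcm : Measurable fun (ω : PoissonSpace 2) v => count F (B v) ω :=
    measurable_pi_lambda _ fun v => measurable_count F (hBm v)
  have hfst : drivingLaw.map (fun ω : DrivingSpace => ω.1) = poissonLaw 2 :=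
    (measurePreserving_fst (μ := poissonLaw 2)).map_eq
  show drivingLaw.map _ = _
  rw [blowupLaw, ← hlaw, ← hfst, Measure.map_map hcm measurable_fst,
    Measure.map_map (measurable_of_countable _) (hcm.comp measurable_fst)]
  refine Measure.map_congr ?_
  filter_upwards [ae_drivingLaw] with ω hω
  obtain ⟨hθ, hζ, hχ, hη⟩ := hω
  show (graphexProcess (strGraphex G) r ω).unlabel =
    (G.blowup fun v => count F (B v) ω.1).unlabel
  -- The vertices of the process, and the vertex of `G` of which each of them is a clone.
  let P : Fin n → Set (PointIndex 2) := fun v =>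
    {i | IsPoint ω.1 i ∧ (fun k => coord ω.1 i k) ∈ B v}
  have hP : ∀ v, (P v).Finite ∧ (P v).ncard = count F (B v) ω.1 := fun v =>
    finite_and_card_eq_count F (B v) (hF v) ω.1
  let J : Set (PointIndex 2) := ⋃ v, P v
  have hJ : Finite J := (Set.finite_iUnion fun v => (hP v).1).to_subtype
  have hex : ∀ j : J, ∃ v, (j : PointIndex 2) ∈ P v := fun j => Set.mem_iUnion.1 j.2
  choose κ hκ using hex
  have hκ' : ∀ (j : J) v, (j : PointIndex 2) ∈ P v → κ j = v := fun j v h =>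
    hdisj _ _ _ (hκ j).2 h.2
  rw [← LoopGraph.unlabel_comap_eq_blowup G _ κ]
  swap
  · intro v
    rw [← (hP v).2, ← Nat.card_coe_set_eq]
    refine Nat.card_congr ⟨fun j => ⟨j.1, by obtain ⟨j, rfl⟩ := j; exact hκ j⟩, fun i =>
      ⟨⟨i.1, Set.mem_iUnion.2 ⟨v, i.2⟩⟩, hκ' _ _ i.2⟩, fun _ => rfl, fun _ => rfl⟩
  have hev : ∀ i j, (graphonEvent (strGraphex G) ω i j ∧ θ ω i ≤ r ∧ θ ω j ≤ r) ↔
      ∃ v w, G.Adj v w ∧ i ∈ P v ∧ j ∈ P w := by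
    intro i j
    have hval : ζ ω s(i, j) ≤ strGraphon G (ϑ ω i) (ϑ ω j) ↔
        ∃ v w, G.Adj v w ∧ ϑ ω i ∈ I v ∧ ϑ ω j ∈ I w := by
      rw [hW]
      split_ifs with h
      · exact ⟨fun _ => h, fun _ => (ω.2.2.2 s(i, j)).2.2⟩
      · exact ⟨fun h' => absurd (le_antisymm h' bot_le) (hζ _), fun h' => absurd h' h⟩
    show (_ ∧ _ ∧ ζ ω s(i, j) ≤ strGraphon G (ϑ ω i) (ϑ ω j)) ∧ _ ↔ _
    rw [hval]
    constructor
    · rintro ⟨⟨h1, h2, v, w, h3, h4, h5⟩, h6, h7⟩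
      exact ⟨v, w, h3, ⟨h1, (hBmem _ _).2 ⟨h6, h4⟩⟩, ⟨h2, (hBmem _ _).2 ⟨h7, h5⟩⟩⟩
    · rintro ⟨v, w, h3, ⟨h1, hi⟩, ⟨h2, hj⟩⟩
      obtain ⟨h6, h4⟩ := (hBmem _ _).1 hi
      obtain ⟨h7, h5⟩ := (hBmem _ _).1 hj
      exact ⟨⟨h1, h2, v, w, h3, h4, h5⟩, h6, h7⟩
  have hadj := graphexProcess_adj_iff (strGraphex G) rfl (fun _ => rfl) r ω hχ hη
  have hinj : ∀ i j, θ ω i = θ ω j → i = j := fun i j h => by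
    by_contra hne
    exact hθ i j hne h
  symm
  refine LoopGraph.unlabel_eq_of_injective _ _ (fun j : J => θ ω j) ?_ ?_ ?_
  · exact fun i j h => Subtype.ext (hinj _ _ h)
  · intro i j
    rw [hadj]
    constructor
    · intro h
      obtain ⟨h1, h2, h3⟩ := (hev i j).2 ⟨_, _, h, hκ i, hκ j⟩
      exact ⟨i, j, h1, rfl, rfl, h2, h3⟩
    · rintro ⟨i', j', h1, hi, hj, h2, h3⟩
      obtain rfl := hinj _ _ hi
      obtain rfl := hinj _ _ hj
      obtain ⟨v, w, h, hv, hw⟩ := (hev _ _).1 ⟨h1, h2, h3⟩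
      show G.Adj (κ i) (κ j)
      rwa [hκ' _ _ hv, hκ' _ _ hw]
  · rintro x ⟨y, h⟩
    obtain ⟨i, j, h1, rfl, rfl, h2, h3⟩ := (hadj _ _).1 h
    obtain ⟨v, w, -, hv, -⟩ := (hev _ _).1 ⟨h1, h2, h3⟩
    exact ⟨⟨i, Set.mem_iUnion.2 ⟨v, hv⟩⟩, rfl⟩

/-! ### Comparison of the two laws -/

/-- `√(2 e(G))`. -/
def edgeScale {n : ℕ} (G : LoopGraph (Fin n)) : ℝ≥0 := NNReal.sqrt (2 * (G.numEdges : ℝ≥0))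

theorem edgeScale_sq {n : ℕ} (G : LoopGraph (Fin n)) :
    (edgeScale G : ℝ) ^ 2 = 2 * G.numEdges := by
  rw [← NNReal.coe_pow, edgeScale, NNReal.sq_sqrt]
  push_cast
  rfl

theorem sqrt_adjCount_sq {n : ℕ} (G : LoopGraph (Fin n)) :
    (NNReal.sqrt (adjCount G) : ℝ) ^ 2 = (edgeScale G : ℝ) ^ 2 + G.numLoops := by
  rw [edgeScale_sq, ← NNReal.coe_pow, NNReal.sq_sqrt, adjCount]
  push_cast
  rfl

theorem edgeScale_le_sqrt_adjCount {n : ℕ} (G : LoopGraph (Fin n)) :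
    edgeScale G ≤ NNReal.sqrt (adjCount G) :=
  NNReal.sqrt_le_sqrt.2 (by rw [adjCount]; exact le_self_add)

theorem adjCount_pos {n : ℕ} (G : LoopGraph (Fin n)) (h : 0 < edgeScale G) : 0 < adjCount G :=
  NNReal.sqrt_pos.1 (h.trans_le (edgeScale_le_sqrt_adjCount G))

/-- If the number of loops is at most a multiple of `√(2 e(G))`, then the two laws agree up to an
error of order `1 / √(2 e(G))`. -/
theorem abs_integral_GPD_sub_sampD_le {n : ℕ} (G : LoopGraph (Fin n)) (r : ℝ≥0) {C M : ℝ}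
    (hG1 : 1 ≤ edgeScale G) (hGr : r ≤ edgeScale G) (hC : (G.numLoops : ℝ) ≤ C * edgeScale G)
    (F : UnlabeledGraph → ℝ) (hF : ∀ x, |F x| ≤ M) :
    |∫ x, F x ∂(GPD (strGraphex G) r : Measure UnlabeledGraph) -
      ∫ x, F x ∂(sampD G r : Measure UnlabeledGraph)| ≤
      2 * M * ((r + C) * (r * C + r ^ 2)) / edgeScale G := by
  have ha : 0 < edgeScale G := zero_lt_one.trans_le hG1
  have hab := edgeScale_le_sqrt_adjCount G
  have hM : 0 ≤ M := (abs_nonneg _).trans (hF (UnlabeledGraph.mk LoopGraph.empty))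
  have hp : r / edgeScale G ≤ 1 := div_le_one_of_le₀ hGr bot_le
  have hqp : r / NNReal.sqrt (adjCount G) ≤ r / edgeScale G :=
    div_le_div_of_nonneg_left bot_le ha hab
  have hsamp : (sampD G r : Measure UnlabeledGraph) =
      blowupLaw G (bernoulliNat (r / edgeScale G)) := by
    rw [sampD, sampling_eq_blowupLaw, ← edgeScale, min_eq_left hp]
  rw [GPD_strGraphex_eq_blowupLaw G (adjCount_pos G ha), hsamp]
  refine (abs_integral_blowupLaw_sub_le G hqp hp F hF).trans ?_
  rw [mul_div_assoc]
  refine mul_le_mul_of_nonneg_left ?_ (by positivity)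
  have hsq := sqrt_adjCount_sq G
  rw [← edgeScale_sq, NNReal.coe_div, NNReal.coe_div]
  have ha' : (0 : ℝ) < edgeScale G := ha
  have hab' : (edgeScale G : ℝ) ≤ NNReal.sqrt (adjCount G) := hab
  have hr' : (0 : ℝ) ≤ r := r.2
  have hl : (0 : ℝ) ≤ G.numLoops := Nat.cast_nonneg _
  generalize (edgeScale G : ℝ) = a at *
  generalize (NNReal.sqrt (adjCount G) : ℝ) = b at *
  generalize (G.numLoops : ℝ) = l at *
  generalize (r : ℝ) = r at *
  have hb' : 0 < b := ha'.trans_le hab'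
  have hC0 : 0 ≤ C := by
    by_contra h
    push Not at h
    nlinarith
  have hba : b - a ≤ C := by
    have h1 : (b - a) * a ≤ C * a := by nlinarith
    exact le_of_mul_le_mul_right h1 ha'
  have h1 : r / a - r / b ≤ r * C / a ^ 2 := by
    have : r / a - r / b = r * (b - a) / (a * b) := by
      field_simp
    rw [this]
    have h2 : a ^ 2 ≤ a * b := by nlinarith
    exact div_le_div₀ (by positivity) (mul_le_mul_of_nonneg_left hba hr') (by positivity) h2
  have h2 : (r / b) ^ 2 ≤ r ^ 2 / a ^ 2 := by
    rw [div_pow]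
    exact div_le_div_of_nonneg_left (by positivity) (by positivity) (by nlinarith)
  have h3 : a ^ 2 * (r / a) + l ≤ a * (r + C) := by
    have : a ^ 2 * (r / a) = a * r := by
      field_simp
    rw [this]
    linarith
  calc (a ^ 2 * (r / a) + l) * (r / a - r / b + (r / b) ^ 2)
      ≤ a * (r + C) * (r * C / a ^ 2 + r ^ 2 / a ^ 2) :=
        mul_le_mul h3 (add_le_add h1 h2)
          (add_nonneg (sub_nonneg.2 (div_le_div_of_nonneg_left hr' ha' hab')) (by positivity))
          (by positivity)
    _ = (r + C) * (r * C + r ^ 2) / a := by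
        field_simp

/-! ### Convergence bounds the number of loops -/

/-- In a weakly convergent sequence of laws the generating function `𝔼 2 ^ (-L)` of the number `L`
of loops stays away from zero. -/
theorem exists_bound_of_tendsto {μ : ℕ → ProbabilityMeasure UnlabeledGraph}
    {μ₀ : ProbabilityMeasure UnlabeledGraph} (h : Tendsto μ atTop (𝓝 μ₀)) (x : ℕ → ℝ)
    (hx : ∀ᶠ j in atTop,
      ∫ q, (1 / 2 : ℝ) ^ q.numLoops ∂(μ j : Measure UnlabeledGraph) ≤ Real.exp (-(x j) / 2)) :
    ∃ K : ℝ, 0 ≤ K ∧ ∀ᶠ j in atTop, x j ≤ K := by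
  let φ : BoundedContinuousFunction UnlabeledGraph ℝ :=
    BoundedContinuousFunction.ofNormedAddCommGroup (fun q => (1 / 2 : ℝ) ^ q.numLoops)
      continuous_of_discreteTopology 1 fun q => by
        rw [Real.norm_of_nonneg (by positivity)]
        exact pow_le_one₀ (by norm_num) (by norm_num)
  have hlim := ProbabilityMeasure.tendsto_iff_forall_integral_tendsto.1 h φ
  set c := ∫ q, φ q ∂(μ₀ : Measure UnlabeledGraph) with hc
  have hpos : 0 < c := by
    rw [hc, integral_pos_iff_support_of_nonneg (fun q => by simp [φ]) (φ.integrable _)]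
    have : Function.support φ = Set.univ := by
      ext q
      simp [φ]
    rw [this, measure_univ]
    exact one_pos
  refine ⟨2 * |Real.log (c / 2)|, by positivity, ?_⟩
  filter_upwards [hx, hlim.eventually_const_lt (half_lt_self hpos)] with j h1 h2
  have h3 : c / 2 ≤ Real.exp (-(x j) / 2) := h2.le.trans h1
  have h4 := (Real.log_le_iff_le_exp (half_pos hpos)).2 h3
  linarith [neg_abs_le (Real.log (c / 2))]

/-- For sampling, `𝔼 2 ^ (-L) ≤ exp (-ℓ / (2 √(2 e(G))))`, where `ℓ` is the number of loops
of `G`. -/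
theorem exists_numLoops_le_of_sampD {n : ℕ → ℕ} (G : ∀ j, LoopGraph (Fin (n j)))
    (hG : ∀ᶠ j in atTop, 1 ≤ edgeScale (G j)) {μ₀ : ProbabilityMeasure UnlabeledGraph}
    (h : Tendsto (fun j => sampD (G j) 1) atTop (𝓝 μ₀)) :
    ∃ C : ℝ, ∀ᶠ j in atTop, ((G j).numLoops : ℝ) ≤ C * edgeScale (G j) := by
  obtain ⟨K, -, hK⟩ := exists_bound_of_tendsto h
    (fun j => (G j).numLoops / (edgeScale (G j) : ℝ)) (by
      filter_upwards [hG] with j hj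
      have hp : 1 / edgeScale (G j) ≤ 1 := div_le_one_of_le₀ hj bot_le
      have := isProbabilityMeasure_bernoulliNat hp
      rw [sampD, sampling_eq_blowupLaw, ← edgeScale, min_eq_left hp,
        integral_two_inv_pow_numLoops, integral_two_inv_pow_bernoulliNat hp]
      have h1 : 1 - ((1 / edgeScale (G j) : ℝ≥0) : ℝ) / 2 ≤
          Real.exp (-((1 / edgeScale (G j) : ℝ≥0) : ℝ) / 2) := by
        have := Real.add_one_le_exp (-((1 / edgeScale (G j) : ℝ≥0) : ℝ) / 2)
        linarith
      have h2 : (0 : ℝ) ≤ 1 - ((1 / edgeScale (G j) : ℝ≥0) : ℝ) / 2 := by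
        have : ((1 / edgeScale (G j) : ℝ≥0) : ℝ) ≤ 1 := hp
        linarith
      refine (pow_le_pow_left₀ h2 h1 _).trans (le_of_eq ?_)
      rw [← Real.exp_nat_mul]
      congr 1
      push_cast
      ring)
  refine ⟨K, ?_⟩
  filter_upwards [hK, hG] with j h1 h2
  exact (div_le_iff₀ (lt_of_lt_of_le one_pos (show (1 : ℝ) ≤ _ from h2))).1 h1

/-- For the graphex process, `𝔼 2 ^ (-L) = exp (-ℓ / (2 √(2 e(G) + ℓ)))`; a bound on
`ℓ / √(2 e(G) + ℓ)` implies one on `ℓ / √(2 e(G))`. -/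
theorem exists_numLoops_le_of_GPD {n : ℕ → ℕ} (G : ∀ j, LoopGraph (Fin (n j)))
    (hG : ∀ᶠ j in atTop, 1 ≤ edgeScale (G j)) {μ₀ : ProbabilityMeasure UnlabeledGraph}
    (h : Tendsto (fun j => GPD (strGraphex (G j)) 1) atTop (𝓝 μ₀)) :
    ∃ C : ℝ, ∀ᶠ j in atTop, ((G j).numLoops : ℝ) ≤ C * edgeScale (G j) := by
  obtain ⟨K, hK0, hK⟩ := exists_bound_of_tendsto h
    (fun j => (G j).numLoops / (NNReal.sqrt (adjCount (G j)) : ℝ)) (by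
      filter_upwards [hG] with j hj
      rw [GPD_strGraphex_eq_blowupLaw _ (adjCount_pos _ (one_pos.trans_le hj)),
        integral_two_inv_pow_numLoops, integral_two_inv_pow_poissonMeasure, ← Real.exp_nat_mul]
      refine le_of_eq (congrArg Real.exp ?_)
      push_cast
      ring)
  refine ⟨K * (1 + K), ?_⟩
  filter_upwards [hK, hG] with j h1 h2
  have hsq := sqrt_adjCount_sq (G j)
  have h2' : (1 : ℝ) ≤ edgeScale (G j) := h2
  have hab : (edgeScale (G j) : ℝ) ≤ NNReal.sqrt (adjCount (G j)) :=
    edgeScale_le_sqrt_adjCount (G j)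
  rw [div_le_iff₀ (by linarith)] at h1
  generalize (edgeScale (G j) : ℝ) = a at *
  generalize (NNReal.sqrt (adjCount (G j)) : ℝ) = b at *
  generalize ((G j).numLoops : ℝ) = l at *
  -- From `b ^ 2 ≤ a ^ 2 + K * b` follows `b ≤ a + K`.
  have hb : b ≤ a + K := by
    by_contra hcon
    push Not at hcon
    nlinarith
  have h3 := mul_le_mul_of_nonneg_left hb hK0
  have h4 : 0 ≤ K * K * (a - 1) := mul_nonneg (mul_self_nonneg K) (by linarith)
  linarith

theorem tendsto_edgeScale {n : ℕ → ℕ} (G : ∀ j, LoopGraph (Fin (n j)))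
    (hG : Tendsto (fun j => (G j).numEdges) atTop atTop) :
    Tendsto (fun j => (edgeScale (G j) : ℝ)) atTop atTop := by
  have h : ∀ j, (edgeScale (G j) : ℝ) = Real.sqrt (2 * ((G j).numEdges : ℝ)) := by
    intro j
    rw [← edgeScale_sq]
    exact (Real.sqrt_sq (edgeScale (G j)).2).symm
  simp_rw [h]
  exact Real.tendsto_sqrt_atTop.comp
    ((tendsto_natCast_atTop_atTop.comp hG).const_mul_atTop two_pos)

/-- If the number of loops is of the order of `√(2 e(G))`, then the two sequences of laws have the
same limits. -/
theorem tendsto_sampD_iff_tendsto_GPD {n : ℕ → ℕ} (G : ∀ j, LoopGraph (Fin (n j)))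
    (hG : Tendsto (fun j => (G j).numEdges) atTop atTop) {C : ℝ}
    (hC : ∀ᶠ j in atTop, ((G j).numLoops : ℝ) ≤ C * edgeScale (G j)) (r : ℝ≥0)
    (μ₀ : ProbabilityMeasure UnlabeledGraph) :
    Tendsto (fun j => sampD (G j) r) atTop (𝓝 μ₀) ↔
      Tendsto (fun j => GPD (strGraphex (G j)) r) atTop (𝓝 μ₀) := by
  rw [ProbabilityMeasure.tendsto_iff_forall_integral_tendsto,
    ProbabilityMeasure.tendsto_iff_forall_integral_tendsto]
  have hscale := tendsto_edgeScale G hG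
  refine forall_congr' fun f => tendsto_iff_of_dist ?_
  refine squeeze_zero' (Eventually.of_forall fun _ => dist_nonneg) ?_
    (hscale.const_div_atTop (2 * ‖f‖ * ((r + C) * (r * C + r ^ 2))))
  filter_upwards [hC, hscale.eventually_ge_atTop 1, hscale.eventually_ge_atTop (r : ℝ)]
    with j h1 h2 h3
  rw [dist_comm, Real.dist_eq]
  exact abs_integral_GPD_sub_sampD_le (G j) r h2 h3 h1 f fun x => f.norm_coe_le_norm x

end

end GraphexSampling

theorem mainTheorem11 (n : ℕ → ℕ) (G : ∀ j, LoopGraph (Fin (n j)))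
    (hG : Tendsto (fun j => (G j).numEdges) atTop atTop) (𝓦 : Graphex) :
    SamplingConvergent G 𝓦 ↔
      ∀ r : ℝ≥0, Tendsto (fun j => GPD (strGraphex (G j)) r) atTop (𝓝 (GPD 𝓦 r)) := by
  have hscale : ∀ᶠ j in atTop, 1 ≤ edgeScale (G j) :=
    (tendsto_edgeScale G hG).eventually_ge_atTop 1
  constructor
  · intro h r
    obtain ⟨C, hC⟩ := exists_numLoops_le_of_sampD G hscale (h 1)
    exact (tendsto_sampD_iff_tendsto_GPD G hG hC r _).1 (h r)
  · intro h r
    obtain ⟨C, hC⟩ := exists_numLoops_le_of_GPD G hscale (h 1)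
    exact (tendsto_sampD_iff_tendsto_GPD G hG hC r _).2 (h r)
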